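/- **Theorem 1.** For a group $G$ with a finite generating set $S$, let $F_{G,S}(n)$ be the number of elements of $G$ that are products of at most $n$ elements of $S\cup S^{-1}$, let $\omega(G,S)=\lim_{n\to\infty}F_{G,S}(n)^{1/n}$ be the exponential growth rate of $G$ with respect to $S$, and let $\Omega(G)=\inf_S\omega(G,S)$, the infimum over all finite generating sets $S$ of $G$, be the minimal exponential growth rate of $G$. For $n\ge 2$ let $$BS(1,n)=\langle a,t\mid tat^{-1}=a^n\rangle$$ be the Baumslag–Solitar group, and let $\mathcal L_n=(\mathbb Z/n\mathbb Z)\wr\mathbb Z=\bigl(\bigoplus_{\mathbb Z}\mathbb Z/n\mathbb Z\bigr)\rtimes\mathbb Z$ be the lamplighter group (the restricted wreath product), with canonical generators $a$, the generator of the copy of $\mathbb Z/n\mathbb Z$ at position $0$, and $t$, the generator of $\mathbb Z$. Let $p$ be a prime. Then $\Omega(\mathcal L_p)=\omega(\mathcal L_p,\{a,t\})$ and $\Omega(BS(1,p))=\omega(BS(1,p),\{a,t\})$; that is, both minimal growth rates are attained on the canonical generators. Moreover: 1. If $p=2k+1$ is odd, then $$\Omega(\mathcal L_p)=\Omega(BS(1,p))=\omega_k,$$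 where $\omega_k$ is the unique positive root of $x^{k+1}-x^k-2x^{k-1}-\dots-2x-2$. 2. If $p=2$, then $$\Omega(\mathcal L_2)=\frac{1+\sqrt5}{2}<\Omega(BS(1,2))=\beta,$$ where $\beta\approx 1.69562$ is the unique positive root of $z^3-z^2-2$. -/

import Mathlib

open Filter Topology Polynomial

namespace GroupGrowth

variable {G : Type*} [Group G]

/-- The word length `ℓ_{G,S}(g)`: the minimal length of a product of elements of `S ∪ S⁻¹` equal
to `g` (it is `⊤` exactly if there is no such product). -/
noncomputable def wordLength (S : Set G) (g : G) : ℕ∞ :=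
  ⨅ l ∈ {l : List G | (∀ s ∈ l, s ∈ S ∨ s⁻¹ ∈ S) ∧ l.prod = g}, (l.length : ℕ∞)

/-- The ball of radius `n` around the identity. -/
def ball (S : Set G) (n : ℕ) : Set G := {g | wordLength S g ≤ n}

/-- The growth function `F_{G,S}`. -/
noncomputable def growthFunction (S : Set G) (n : ℕ) : ℕ := (ball S n).ncard

/-- The exponential growth rate `ω(G, S) = lim F_{G,S}(n)^{1/n}`. -/
noncomputable def growthRate (S : Set G) : ℝ :=
  limUnder atTop fun n : ℕ ↦ (growthFunction S n : ℝ) ^ (1 / (n : ℝ))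

/-- `S` is a finite generating set of the group. -/
def IsFiniteGeneratingSet (S : Set G) : Prop := S.Finite ∧ Subgroup.closure S = ⊤

variable (G) in
/-- The minimal exponential growth rate `Ω(G)`: the infimum of `ω(G, S)` over all finite
generating sets `S`. -/
noncomputable def minimalGrowthRate : ℝ :=
  sInf {w : ℝ | ∃ S : Set G, IsFiniteGeneratingSet S ∧ growthRate S = w}

/-- The minimal growth rate of the group is realized on the finite generating set `S`. -/
def RealizesMinimalGrowthRate (S : Set G) : Prop :=
  IsFiniteGeneratingSet S ∧ growthRate S = minimalGrowthRate G

/-! The limit that defines `growthRate` exists and is at least `1` for every finite set, so the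
infimum that defines `minimalGrowthRate` is one over a set that is bounded below. -/

theorem mem_ball_iff {S : Set G} {n : ℕ} {g : G} :
    g ∈ ball S n ↔ ∃ l : List G, (∀ s ∈ l, s ∈ S ∨ s⁻¹ ∈ S) ∧ l.prod = g ∧ l.length ≤ n := by
  constructor
  · intro h
    by_contra! hc
    have : ((n + 1 : ℕ) : ℕ∞) ≤ wordLength S g := by
      refine le_iInf₂ fun l hl ↦ ?_
      exact_mod_cast hc l hl.1 hl.2
    have h2 := this.trans h
    have h3 : n + 1 ≤ n := by exact_mod_cast h2
    omega
  · rintro ⟨l, h1, h2, h3⟩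
    have h4 : wordLength S g ≤ l.length := iInf₂_le_of_le l ⟨h1, h2⟩ le_rfl
    exact h4.trans (by exact_mod_cast h3)

theorem ball_finite {S : Set G} (hS : S.Finite) (n : ℕ) : (ball S n).Finite := by
  have hT : {s : G | s ∈ S ∨ s⁻¹ ∈ S}.Finite := hS.union (hS.preimage inv_injective.injOn)
  have := Set.finite_coe_iff.mpr hT
  refine ((List.finite_length_le {s : G | s ∈ S ∨ s⁻¹ ∈ S} n).image
    fun l ↦ (l.map Subtype.val).prod).subset ?_
  intro g hg
  obtain ⟨l, h1, h2, h3⟩ := mem_ball_iff.mp hg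
  refine ⟨l.attach.map fun x ↦ ⟨x.1, h1 x.1 x.2⟩, by simpa using h3, ?_⟩
  simpa [List.map_map, Function.comp_def] using h2

theorem one_le_growthFunction {S : Set G} (hS : S.Finite) (n : ℕ) : 1 ≤ growthFunction S n :=
  (Set.ncard_pos (ball_finite hS n)).mpr ⟨1, mem_ball_iff.mpr ⟨[], by simp⟩⟩

theorem growthFunction_add_le {S : Set G} (hS : S.Finite) (m n : ℕ) :
    growthFunction S (m + n) ≤ growthFunction S m * growthFunction S n := by
  unfold growthFunction
  rw [← Set.ncard_prod]
  refine le_trans (Set.ncard_le_ncard ?_ (((ball_finite hS m).prod (ball_finite hS n)).image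
    fun x : G × G ↦ x.1 * x.2)) (Set.ncard_image_le ((ball_finite hS m).prod (ball_finite hS n)))
  intro g hg
  obtain ⟨l, h1, h2, h3⟩ := mem_ball_iff.mp hg
  refine ⟨((l.take m).prod, (l.drop m).prod), ⟨?_, ?_⟩, ?_⟩
  · exact mem_ball_iff.mpr ⟨_, fun s hs ↦ h1 s (List.mem_of_mem_take hs), rfl, by simp⟩
  · exact mem_ball_iff.mpr ⟨_, fun s hs ↦ h1 s (List.mem_of_mem_drop hs), rfl, by simp; omega⟩
  · simp [← h2, List.prod_take_mul_prod_drop]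

theorem tendsto_growthRate {S : Set G} (hS : S.Finite) :
    Tendsto (fun n : ℕ ↦ (growthFunction S n : ℝ) ^ (1 / (n : ℝ))) atTop (𝓝 (growthRate S)) := by
  refine tendsto_nhds_limUnder ?_
  have hpos : ∀ n, (0 : ℝ) < growthFunction S n := fun n ↦ by
    exact_mod_cast one_le_growthFunction hS n
  have hsub : Subadditive fun n ↦ Real.log (growthFunction S n) := fun m n ↦ by
    rw [← Real.log_mul (hpos m).ne' (hpos n).ne']
    exact Real.log_le_log (hpos _) (by exact_mod_cast growthFunction_add_le hS m n)
  have hbdd : BddBelow (Set.range fun n : ℕ ↦ Real.log (growthFunction S n) / n) := by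
    refine ⟨0, ?_⟩
    rintro _ ⟨n, rfl⟩
    exact div_nonneg (Real.log_natCast_nonneg _) n.cast_nonneg
  refine ⟨Real.exp hsub.lim, ?_⟩
  refine ((Real.continuous_exp.tendsto _).comp (hsub.tendsto_lim hbdd)).congr fun n ↦ ?_
  simp [Real.rpow_def_of_pos (hpos n), div_eq_mul_inv]

theorem one_le_growthRate {S : Set G} (hS : S.Finite) : 1 ≤ growthRate S :=
  ge_of_tendsto' (tendsto_growthRate hS) fun n ↦
    Real.one_le_rpow (by exact_mod_cast one_le_growthFunction hS n) (by positivity)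

end GroupGrowth

/-- The shift action of `ℤ` on `⨁_ℤ ℤ/nℤ`: `m` sends the configuration `f` to
`i ↦ f (i - m)`. -/
noncomputable def lampShift (n : ℕ) : Multiplicative ℤ →* MulAut (Multiplicative (ℤ →₀ ZMod n)) where
  toFun m := AddEquiv.toMultiplicative (Finsupp.domCongr (Equiv.addRight m.toAdd))
  map_one' := by
    refine MulEquiv.ext fun f ↦ Multiplicative.toAdd.injective (Finsupp.ext fun i ↦ ?_)
    change f.toAdd (i + -0) = f.toAdd i
    simp
  map_mul' a b := by
    refine MulEquiv.ext fun f ↦ Multiplicative.toAdd.injective (Finsupp.ext fun i ↦ ?_)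
    change f.toAdd (i + -(a.toAdd + b.toAdd)) = f.toAdd (i + -a.toAdd + -b.toAdd)
    congr 1
    ring

/-- The lamplighter group `ℒ_n = (ℤ/nℤ) ≀ ℤ`, i.e. the restricted wreath product
`(⨁_ℤ ℤ/nℤ) ⋊ ℤ`. -/
abbrev Lamplighter (n : ℕ) : Type :=
  Multiplicative (ℤ →₀ ZMod n) ⋊[lampShift n] Multiplicative ℤ

namespace Lamplighter

/-- The generator `a`: the configuration with value `1` at the origin and `0` elsewhere. -/
noncomputable def a (n : ℕ) : Lamplighter n :=
  SemidirectProduct.inl (Multiplicative.ofAdd (Finsupp.single 0 1))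

/-- The generator `t` of the factor `ℤ`. -/
noncomputable def t (n : ℕ) : Lamplighter n := SemidirectProduct.inr (Multiplicative.ofAdd 1)

end Lamplighter

/-- The relators of `⟨a, t | t a t⁻¹ = a ^ n⟩`, where `a` is the letter `0` and `t` the letter
`1`. -/
def bsRelators (n : ℕ) : Set (FreeGroup (Fin 2)) :=
  {FreeGroup.of 1 * FreeGroup.of 0 * (FreeGroup.of 1)⁻¹ * (FreeGroup.of 0 ^ n)⁻¹}

/-- The Baumslag-Solitar group `BS(1, n) = ⟨a, t | t a t⁻¹ = a ^ n⟩`. -/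
abbrev BS (n : ℕ) : Type := PresentedGroup (bsRelators n)

namespace BS

/-- The generator `a`. -/
def a (n : ℕ) : BS n := PresentedGroup.of 0

/-- The generator `t`. -/
def t (n : ℕ) : BS n := PresentedGroup.of 1

end BS

/-- The polynomial `x^(k+1) - x^k - 2 x^(k-1) - ⋯ - 2 x - 2`. -/
noncomputable def growthPoly (k : ℕ) : ℝ[X] :=
  X ^ (k + 1) - X ^ k - ∑ i ∈ Finset.range k, C 2 * X ^ i

/-- `r` is the unique positive root of `P`. -/
def IsUniquePositiveRoot (P : ℝ[X]) (r : ℝ) : Prop :=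
  0 < r ∧ P.IsRoot r ∧ ∀ s : ℝ, 0 < s → P.IsRoot s → s = r

/-! Upper bounds. Since the conjugates t^i a t^(-i) commute with a, an element of the n-ball of {a,
t} is t^(-A) d t^m, where d = a^c₁ t a^c₂ t ⋯ a^e is a digit string of cost at most n
(`exists_digitExpansion_of_mem_ball`). The factors A and m contribute only polynomially. Digits can
be normalized from the left at no cost: to -k, …, k for p = 2k+1 (`exists_balanced_digit`), to 0, 1
in the binary lamplighter group, and to non-adjacent forms in BS(1,2). Normalized strings obey a
linear recursion whose characteristic equation defines the claimed rate (`growthRate_le_of_digits`,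
`growthRate_le_of_nonadjacent`).

Lower bounds. Both groups act by affine maps u ↦ π^h u + c on a local field: F_p((T)) with π = T, or
Q_p with π = p. The actions need not be faithful, because distinct images come from distinct
elements. Any generating set contains, up to inversion and a change of coordinate, x : u ↦ π^h u
with h > 0 and a y : u ↦ π^h' u + 1 with h' = 0 or h ≤ h' (`exists_normalized`). Words in x and y
that send a set X into itself with disjoint images are counted by `inv_le_growthRate_of_pingPong`.

If h' = 0, the words y^i x reproduce the digit strings of the upper bound. If h' ≥ h, then x and y
generate a free semigroup and the rate is at least 2, which settles p = 2 and p = 3. For p ≥ 5 and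
h' = h, the element y x⁻¹ is a translation and again yields digits. For h' > h, a richer family of
words, told apart by their leading terms in π, beats every number below 1 + √2
(`inv_le_growthRate_of_family`), and ω_k < 1 + √2. -/

namespace GroupGrowth

variable {G : Type*} [Group G]

/-! ### Balls and comparison of growth rates -/

theorem one_mem_ball (S : Set G) (n : ℕ) : (1 : G) ∈ ball S n :=
  mem_ball_iff.mpr ⟨[], by simp⟩

theorem ball_mono (S : Set G) {m n : ℕ} (h : m ≤ n) : ball S m ⊆ ball S n := fun _ hg ↦ by
  obtain ⟨l, h1, h2, h3⟩ := mem_ball_iff.mp hg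
  exact mem_ball_iff.mpr ⟨l, h1, h2, h3.trans h⟩

theorem mem_ball_one {S : Set G} {s : G} (h : s ∈ S ∨ s⁻¹ ∈ S) : s ∈ ball S 1 :=
  mem_ball_iff.mpr ⟨[s], by simpa using h⟩

theorem mul_mem_ball {S : Set G} {m n : ℕ} {g h : G} (hg : g ∈ ball S m) (hh : h ∈ ball S n) :
    g * h ∈ ball S (m + n) := by
  obtain ⟨l, h1, h2, h3⟩ := mem_ball_iff.mp hg
  obtain ⟨l', h1', h2', h3'⟩ := mem_ball_iff.mp hh
  refine mem_ball_iff.mpr ⟨l ++ l', fun s hs ↦ ?_, by simp [h2, h2'], by simp; omega⟩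
  exact (List.mem_append.mp hs).elim (h1 s) (h1' s)

theorem pow_mem_ball {S : Set G} {m : ℕ} {g : G} (hg : g ∈ ball S m) (n : ℕ) :
    g ^ n ∈ ball S (n * m) := by
  induction n with
  | zero => simpa using one_mem_ball S 0
  | succ n ih => rw [pow_succ, Nat.succ_mul]; exact mul_mem_ball ih hg

theorem zpow_mem_ball {S : Set G} {g : G} (hg : g ∈ S ∨ g⁻¹ ∈ S) (n : ℤ) :
    g ^ n ∈ ball S n.natAbs := by
  obtain ⟨m, rfl | rfl⟩ := n.eq_nat_or_neg
  · simpa using pow_mem_ball (mem_ball_one hg) m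
  · have hg' : g⁻¹ ∈ S ∨ g⁻¹⁻¹ ∈ S := by rw [inv_inv]; exact hg.symm
    simpa using pow_mem_ball (mem_ball_one hg') m

theorem pow_le_of_le_rpow {ρ F : ℝ} (hρ : 0 ≤ ρ) (hF : 0 ≤ F) {n : ℕ} (hn : n ≠ 0)
    (h : ρ ≤ F ^ (1 / (n : ℝ))) : ρ ^ n ≤ F := by
  have := pow_le_pow_left₀ hρ h n
  rwa [one_div, Real.rpow_inv_natCast_pow hF hn] at this

theorem le_pow_of_rpow_le {ρ F : ℝ} (hF : 0 ≤ F) {n : ℕ} (hn : n ≠ 0)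
    (h : F ^ (1 / (n : ℝ)) ≤ ρ) : F ≤ ρ ^ n := by
  have := pow_le_pow_left₀ (Real.rpow_nonneg hF _) h n
  rwa [one_div, Real.rpow_inv_natCast_pow hF hn] at this

/-- A growth function bounded by a polynomial times `z ^ n` has growth rate at most `z`. -/
theorem growthRate_le {S : Set G} (hS : S.Finite) {z C : ℝ} (hz : 0 < z) (d : ℕ)
    (h : ∀ n : ℕ, (growthFunction S n : ℝ) ≤ C * ((n : ℝ) + 1) ^ d * z ^ n) :
    growthRate S ≤ z := by
  by_contra! hlt
  obtain ⟨ρ, h1, h2⟩ := exists_between hlt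
  have hρ : 0 < ρ := hz.trans h1
  have hC : 0 ≤ C := by
    have := h 0
    simp only [CharP.cast_eq_zero, zero_add, one_pow, mul_one, pow_zero] at this
    exact (Nat.cast_nonneg _).trans this
  -- The factor 2 ^ d absorbs the passage from (n + 1) ^ d to n ^ d for n ≥ 1.
  have hlim : Tendsto (fun n : ℕ ↦ C * 2 ^ d * ((n : ℝ) ^ d * (z / ρ) ^ n)) atTop (𝓝 0) := by
    have := tendsto_pow_const_mul_const_pow_of_abs_lt_one d
      (show |z / ρ| < 1 by rw [abs_of_pos (by positivity)]; exact (div_lt_one hρ).mpr h1)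
    simpa using this.const_mul (C * 2 ^ d)
  obtain ⟨n, hn1, hn2, hn3⟩ := ((hlim.eventually (gt_mem_nhds one_pos)).and
    (((tendsto_growthRate hS).eventually (lt_mem_nhds h2)).and (eventually_ge_atTop 1))).exists
  have h4 := pow_le_of_le_rpow hρ.le (Nat.cast_nonneg _) (by omega) hn2.le
  have h5 := h4.trans (h n)
  have h6 : ((n : ℝ) + 1) ^ d ≤ 2 ^ d * (n : ℝ) ^ d := by
    rw [← mul_pow]
    have : (1 : ℝ) ≤ n := by exact_mod_cast hn3
    exact pow_le_pow_left₀ (by positivity) (by linarith) d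
  have h7 : ρ ^ n ≤ (C * 2 ^ d * (n : ℝ) ^ d) * z ^ n := h5.trans
    (mul_le_mul_of_nonneg_right
      (by rw [mul_assoc C]; exact mul_le_mul_of_nonneg_left h6 hC) (by positivity))
  have h8 : C * 2 ^ d * ((n : ℝ) ^ d * (z / ρ) ^ n) * ρ ^ n = (C * 2 ^ d * (n : ℝ) ^ d) * z ^ n := by
    rw [div_pow]; field_simp
  have h9 : 0 < ρ ^ n := by positivity
  nlinarith

/-! ### Ping-pong and generating functions -/

section PingPong

variable {α ι : Type*} (φ : G →* Equiv.Perm α) (w : ι → G) {X : Set α}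

theorem prod_ofFn_apply_mem (hmap : ∀ i, ∀ u ∈ X, φ (w i) u ∈ X) {u : α} (hu : u ∈ X) :
    ∀ (n : ℕ) (l : Fin n → ι), φ (List.ofFn fun j ↦ w (l j)).prod u ∈ X := by
  intro n
  induction n with
  | zero => simpa using hu
  | succ n ih =>
    intro l
    rw [List.ofFn_succ, List.prod_cons, map_mul, Equiv.Perm.mul_apply]
    exact hmap _ _ (ih fun j ↦ l j.succ)

/-- Ping-pong: words in the `w i` of equal number of factors are determined by their value. -/
theorem prod_ofFn_injective (hX : X.Nonempty) (hmap : ∀ i, ∀ u ∈ X, φ (w i) u ∈ X)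
    (hdisj : ∀ i j, ∀ u ∈ X, ∀ u' ∈ X, φ (w i) u = φ (w j) u' → i = j) (n : ℕ) :
    Function.Injective fun l : Fin n → ι ↦ (List.ofFn fun j ↦ w (l j)).prod := by
  obtain ⟨u, hu⟩ := hX
  induction n with
  | zero => exact Function.injective_of_subsingleton _
  | succ n ih =>
    intro l l' h
    simp only [List.ofFn_succ, List.prod_cons] at h
    have h0 : l 0 = l' 0 := by
      refine hdisj _ _ _ (prod_ofFn_apply_mem φ w hmap hu n fun j ↦ l j.succ) _
        (prod_ofFn_apply_mem φ w hmap hu n fun j ↦ l' j.succ) ?_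
      rw [← Equiv.Perm.mul_apply, ← Equiv.Perm.mul_apply, ← map_mul, ← map_mul, h]
    rw [h0] at h
    have h1 := ih (mul_left_cancel h)
    funext j
    refine Fin.cases h0 (fun j ↦ congrFun h1 j) j

theorem prod_ofFn_mem_ball {S : Set G} {ℓ : ι → ℕ} (hw : ∀ i, w i ∈ ball S (ℓ i)) :
    ∀ (n : ℕ) (l : Fin n → ι), (List.ofFn fun j ↦ w (l j)).prod ∈ ball S (∑ j, ℓ (l j)) := by
  intro n
  induction n with
  | zero => intro l; simpa using one_mem_ball S 0
  | succ n ih =>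
    intro l
    rw [List.ofFn_succ, List.prod_cons, Fin.sum_univ_succ]
    exact mul_mem_ball (hw _) (ih fun j ↦ l j.succ)

/-- If words of lengths `ℓ i` play ping-pong and `∑ x ^ ℓ i ≥ 1`, then the growth rate is at least
`x⁻¹`. -/
theorem inv_le_growthRate_of_pingPong {S : Set G} (hS : S.Finite) (s : Finset ι) {ℓ : ι → ℕ}
    (hw : ∀ i, w i ∈ ball S (ℓ i)) (hℓ : ∀ i, 1 ≤ ℓ i)
    (hX : X.Nonempty) (hmap : ∀ i, ∀ u ∈ X, φ (w i) u ∈ X)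
    (hdisj : ∀ i j, ∀ u ∈ X, ∀ u' ∈ X, φ (w i) u = φ (w j) u' → i = j)
    {x : ℝ} (hx : 0 < x) (hsum : 1 ≤ ∑ i ∈ s, x ^ ℓ i) : x⁻¹ ≤ growthRate S := by
  classical
  by_contra! hlt
  obtain ⟨ρ, h1, h2⟩ := exists_between hlt
  have hρ : 0 < ρ := lt_of_lt_of_le one_pos ((one_le_growthRate hS).trans h1.le)
  have hq0 : 0 < ρ * x := by positivity
  have hq1 : ρ * x < 1 := by
    have := mul_lt_mul_of_pos_right h2 hx
    rwa [inv_mul_cancel₀ hx.ne'] at this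
  obtain ⟨N, hN⟩ := eventually_atTop.mp
    (((tendsto_growthRate hS).eventually (gt_mem_nhds h1)).and (eventually_ge_atTop 1))
  -- Only words with the same number n of factors are known to be distinct, so n is fixed. It is
  -- chosen so that the geometric tail (ρx)^n / (1 - ρx) is below 1, and so large that every word
  -- length lies where F(c) < ρ^c holds. Grouping the expansion of (∑ x ^ ℓ i) ^ n by length then
  -- bounds a sum that is at least 1 by this tail.
  obtain ⟨n, hn1, hn2⟩ := (((tendsto_pow_atTop_nhds_zero_of_lt_one hq0.le hq1).eventually
    (gt_mem_nhds (sub_pos.mpr hq1))).and (eventually_ge_atTop N)).exists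
  set T := Fintype.piFinset fun _ : Fin n ↦ s
  set L : (Fin n → ι) → ℕ := fun l ↦ ∑ j, ℓ (l j)
  have hL : ∀ l, n ≤ L l := fun l ↦ by
    simpa using Finset.sum_le_sum fun j (_ : j ∈ Finset.univ) ↦ hℓ (l j)
  have h3 : (1 : ℝ) ≤ ∑ l ∈ T, x ^ L l := by
    have h4 := one_le_pow₀ hsum (n := n)
    rw [Finset.sum_pow'] at h4
    simpa only [Finset.prod_pow_eq_pow_sum] using h4
  have hfib : ∀ c ∈ T.image L, ∑ l ∈ T with L l = c, x ^ L l ≤ (ρ * x) ^ c := by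
    intro c hc
    obtain ⟨l₀, -, rfl⟩ := Finset.mem_image.mp hc
    have hcard : (T.filter fun l ↦ L l = L l₀).card ≤ growthFunction S (L l₀) := by
      rw [← Set.ncard_coe_finset]
      refine Set.ncard_le_ncard_of_injOn _ (fun l hl ↦ ?_)
        (prod_ofFn_injective φ w hX hmap hdisj n).injOn (ball_finite hS _)
      have := prod_ofFn_mem_ball w hw n l
      rwa [show ∑ j, ℓ (l j) = L l₀ from (Finset.mem_filter.mp hl).2] at this
    have hF : (growthFunction S (L l₀) : ℝ) ≤ ρ ^ L l₀ := by
      have := hN (L l₀) (hn2.trans (hL l₀))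
      exact le_pow_of_rpow_le (Nat.cast_nonneg _) (by omega) this.1.le
    calc ∑ l ∈ T with L l = L l₀, x ^ L l = ∑ l ∈ T with L l = L l₀, x ^ L l₀ :=
          Finset.sum_congr rfl fun l hl ↦ by rw [(Finset.mem_filter.mp hl).2]
      _ = (T.filter fun l ↦ L l = L l₀).card * x ^ L l₀ := by rw [Finset.sum_const, nsmul_eq_mul]
      _ ≤ ρ ^ L l₀ * x ^ L l₀ := by
          gcongr
          exact (Nat.cast_le.mpr hcard).trans hF
      _ = (ρ * x) ^ L l₀ := (mul_pow _ _ _).symm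
  rw [← Finset.sum_fiberwise_of_maps_to fun l hl ↦ Finset.mem_image_of_mem L hl] at h3
  have h5 : ∑ c ∈ T.image L, (ρ * x) ^ c ≤
      ∑ c ∈ Finset.Ico n ((T.image L).sup id + 1), (ρ * x) ^ c := by
    refine Finset.sum_le_sum_of_subset_of_nonneg (fun c hc ↦ ?_) fun c _ _ ↦ by positivity
    obtain ⟨l, -, rfl⟩ := Finset.mem_image.mp hc
    exact Finset.mem_Ico.mpr ⟨hL l, Nat.lt_succ_of_le (Finset.le_sup (f := id) hc)⟩
  have h6 := (h3.trans (Finset.sum_le_sum hfib)).trans (h5.trans (geom_sum_Ico_le_of_lt_one hq0.le hq1))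
  rw [le_div_iff₀ (sub_pos.mpr hq1)] at h6
  linarith

end PingPong

/-! ### Upper bounds from digit expansions -/

/-- `DigitExpansion a t L n g`: the element `g` is of the form
`a ^ c₁ * t * a ^ c₂ * t * ⋯ * a ^ c_L * t * a ^ e` with `L + |c₁| + ⋯ + |c_L| + |e| ≤ n`. -/
inductive DigitExpansion (a t : G) : ℕ → ℕ → G → Prop
  | base (e : ℤ) (n : ℕ) (h : e.natAbs ≤ n) : DigitExpansion a t 0 n (a ^ e)
  | step (c : ℤ) {L m n : ℕ} {g : G} (hg : DigitExpansion a t L m g)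
      (h : c.natAbs + 1 + m ≤ n) : DigitExpansion a t (L + 1) n (a ^ c * t * g)

namespace DigitExpansion

variable {a t : G} {L m n : ℕ} {g : G}

theorem mono (h : DigitExpansion a t L m g) (hmn : m ≤ n) : DigitExpansion a t L n g := by
  cases h with
  | base e _ h => exact base e n (h.trans hmn)
  | step c hg h => exact step c hg (h.trans hmn)

theorem zpow_mul (h : DigitExpansion a t L m g) (q : ℤ) :
    DigitExpansion a t L (m + q.natAbs) (a ^ q * g) := by
  cases h with
  | base e _ h => rw [← zpow_add]; exact base _ _ ((Int.natAbs_add_le q e).trans (by omega))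
  | @step c L m n g hg h =>
    rw [← mul_assoc, ← mul_assoc, ← zpow_add]
    exact step _ hg (by have := Int.natAbs_add_le q c; omega)

theorem mul_left (h : DigitExpansion a t L m g) : DigitExpansion a t (L + 1) (m + 1) (t * g) := by
  simpa using step 0 h (n := m + 1) (by simp; omega)

theorem mul_right (h : DigitExpansion a t L m g) : DigitExpansion a t (L + 1) (m + 1) (g * t) := by
  induction h with
  | base e n h => simpa using step e (base (t := t) (a := a) 0 0 (by simp)) (n := n + 1) (by omega)
  | step c hg h ih => rw [mul_assoc]; exact step c ih (by omega)

/-- Changing a digit. -/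
theorem conj_mul (hcomm : ∀ i : ℕ, Commute (t ^ i * a * (t ^ i)⁻¹) a)
    (h : DigitExpansion a t L m g) {A : ℕ} (hA : A ≤ L) (q : ℤ) :
    DigitExpansion a t L (m + q.natAbs) (t ^ A * a ^ q * (t ^ A)⁻¹ * g) := by
  induction h generalizing A with
  | base e n h =>
    obtain rfl : A = 0 := by omega
    simpa using (base (t := t) e n h).zpow_mul q
  | @step c L m n g hg h ih =>
    cases A with
    | zero => simpa using (step c hg h).zpow_mul q
    | succ A =>
      -- The conjugate passes the leading digit by commutation, and moving it across the next t
      -- lowers its position by one.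
      have h1 : Commute (t ^ (A + 1) * a ^ q * (t ^ (A + 1))⁻¹) (a ^ c) := by
        rw [← conj_zpow]
        exact (hcomm (A + 1)).zpow_zpow q c
      have h2 : t ^ (A + 1) * a ^ q * (t ^ (A + 1))⁻¹ * (a ^ c * t * g) =
          a ^ c * t * (t ^ A * a ^ q * (t ^ A)⁻¹ * g) := by
        rw [mul_assoc (a ^ c), ← mul_assoc _ (a ^ c), h1.eq, pow_succ']
        group
      rw [h2]
      exact step c (ih (by omega)) (by omega)

end DigitExpansion

/-- The number A is a cursor on the digit string. Prepending a letter a^(±1) changes the digit at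
the cursor, and t^(±1) moves the cursor. When the cursor leaves the string, a zero digit is added on
the left, or a t is appended on the right and compensated in t ^ m. -/
theorem exists_digitExpansion_of_mem_ball {a t : G}
    (hcomm : ∀ i : ℕ, Commute (t ^ i * a * (t ^ i)⁻¹) a) {n : ℕ} {g : G}
    (hg : g ∈ ball {a, t} n) :
    ∃ A L : ℕ, ∃ m : ℤ, ∃ d : G, A ≤ L ∧ L ≤ n ∧ m.natAbs ≤ n ∧ DigitExpansion a t L n d ∧
      g = (t ^ A)⁻¹ * d * t ^ m := by
  obtain ⟨l, hl, rfl, hn⟩ := mem_ball_iff.mp hg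
  clear hg
  induction l generalizing n with
  | nil => exact ⟨0, 0, 0, 1, le_rfl, by simp, by simp, 
      by simpa using DigitExpansion.base (a := a) (t := t) 0 n (by simp), by simp⟩
  | cons s l ih =>
    obtain ⟨n, rfl⟩ : ∃ k, n = k + 1 := ⟨n - 1, by simp at hn; omega⟩
    obtain ⟨A, L, m, d, hA, hL, hm, hd, he⟩ :=
      ih (fun s hs ↦ hl s (List.mem_cons_of_mem _ hs)) (n := n) (by simpa using hn)
    have key : (∃ q : ℤ, q.natAbs = 1 ∧ s = a ^ q) ∨ s = t ∨ s = t⁻¹ := by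
      rcases hl s List.mem_cons_self with (rfl | rfl) | (h | h)
      · exact .inl ⟨1, by simp⟩
      · exact .inr (.inl rfl)
      · exact .inl ⟨-1, by simp [← h]⟩
      · exact .inr (.inr (by rw [← Set.mem_singleton_iff.mp h, inv_inv]))
    rw [List.prod_cons, he]
    rcases key with ⟨q, hq, rfl⟩ | rfl | rfl
    · refine ⟨A, L, m, t ^ A * a ^ q * (t ^ A)⁻¹ * d, hA, by omega, by omega, ?_, by group⟩
      exact hq ▸ hd.conj_mul hcomm hA q
    · cases A with
      | zero => exact ⟨0, L + 1, m, s * d, by omega, by omega, by omega, hd.mul_left, by simp [mul_assoc]⟩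
      | succ A =>
        exact ⟨A, L, m, d, by omega, by omega, by omega, hd.mono (by omega), by rw [pow_succ]; group⟩
    · by_cases h : A + 1 ≤ L
      · exact ⟨A + 1, L, m, d, h, by omega, by omega, hd.mono (by omega), by rw [pow_succ]; group⟩
      · exact ⟨A + 1, L + 1, m - 1, d * t, by omega, by omega, by omega, hd.mul_right,
          by rw [pow_succ]; group⟩

/-- The elements with a digit expansion of cost at most `n`. -/
def digitSet (a t : G) (n : ℕ) : Set G := {g | ∃ L, DigitExpansion a t L n g}

theorem growthFunction_le_digitSet {a t : G}
    (hcomm : ∀ i : ℕ, Commute (t ^ i * a * (t ^ i)⁻¹) a) (n : ℕ)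
    (hfin : (digitSet a t n).Finite) :
    growthFunction {a, t} n ≤ (n + 1) * (2 * n + 1) * (digitSet a t n).ncard := by
  set P : Set ((ℕ × ℤ) × G) := (↑(Finset.range (n + 1) ×ˢ Finset.Icc (-n : ℤ) n) : Set (ℕ × ℤ)) ×ˢ
    digitSet a t n
  have hP : P.Finite := (Finset.finite_toSet _).prod hfin
  have hc : P.ncard = (n + 1) * (2 * n + 1) * (digitSet a t n).ncard := by
    rw [Set.ncard_prod, Set.ncard_coe_finset, Finset.card_product, Finset.card_range, Int.card_Icc]
    congr 2
    omega
  rw [← hc]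
  refine le_trans (Set.ncard_le_ncard ?_ (hP.image fun x ↦ (t ^ x.1.1)⁻¹ * x.2 * t ^ x.1.2))
    (Set.ncard_image_le hP)
  intro g hg
  obtain ⟨A, L, m, d, hA, hL, hm, hd, he⟩ := exists_digitExpansion_of_mem_ball hcomm hg
  refine ⟨((A, m), d), ⟨?_, L, hd⟩, he.symm⟩
  simp only [Finset.coe_product, Set.mem_prod, Finset.coe_range, Set.mem_Iio, Finset.coe_Icc,
    Set.mem_Icc]
  omega

/-- Counting by a recursion with weights `ℓ i` whose generating function is at most `1` at
`z⁻¹`. -/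
theorem ncard_le_of_recursion {ι : Type*} (s : Finset ι) (w : ι → G) (ℓ : ι → ℕ)
    (hℓ : ∀ i, 1 ≤ ℓ i) (f base : ℕ → Set G) (B : ℕ → ℕ) (hB : Monotone B)
    (hbase : ∀ n, (base n).Finite ∧ (base n).ncard ≤ B n)
    (hf : ∀ n, ∀ g ∈ f n, g ∈ base n ∨ ∃ i ∈ s, ℓ i ≤ n ∧ ∃ h ∈ f (n - ℓ i), g = w i * h)
    {z : ℝ} (hz : 1 ≤ z) (hs : ∑ i ∈ s, (z⁻¹) ^ ℓ i ≤ 1) (n : ℕ) :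
    (f n).Finite ∧ ((f n).ncard : ℝ) ≤ (n + 1) * B n * z ^ n := by
  classical
  induction n using Nat.strong_induction_on with
  | _ n ih =>
  set U : ι → Set G := fun i ↦ if ℓ i ≤ n then (w i * ·) '' f (n - ℓ i) else ∅
  have hU : ∀ i, (U i).Finite ∧ ((U i).ncard : ℝ) ≤ n * B n * z ^ n * z⁻¹ ^ ℓ i := by
    intro i
    by_cases hi : ℓ i ≤ n
    · have h1 := hℓ i
      obtain ⟨hfin, hle⟩ := ih (n - ℓ i) (by omega)
      simp only [U, if_pos hi]
      refine ⟨hfin.image _, (Nat.cast_le.mpr (Set.ncard_image_le hfin)).trans (hle.trans ?_)⟩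
      have h2 : z ^ n * z⁻¹ ^ ℓ i = z ^ (n - ℓ i) := by
        rw [inv_pow, pow_sub₀ z (by positivity) hi]
      rw [mul_assoc _ (z ^ n), h2]
      -- As ℓ i ≥ 1, the inductive factor is at most n; the missing unit pays for the base set.
      have h3 : ((n - ℓ i : ℕ) : ℝ) + 1 ≤ n := by
        exact_mod_cast (by omega : n - ℓ i + 1 ≤ n)
      have h4 : (B (n - ℓ i) : ℝ) ≤ B n := by exact_mod_cast hB (by omega)
      gcongr
    · simp only [U, if_neg hi]
      exact ⟨Set.finite_empty, by simp; positivity⟩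
  have hsub : f n ⊆ base n ∪ ⋃ i ∈ s, U i := by
    intro g hg
    rcases hf n g hg with h | ⟨i, hi, hin, h, hh, rfl⟩
    · exact .inl h
    · refine .inr (Set.mem_biUnion (show i ∈ (s : Set ι) from hi) ?_)
      simp only [U, if_pos hin]
      exact ⟨h, hh, rfl⟩
  have hfinU : (⋃ i ∈ s, U i).Finite := s.finite_toSet.biUnion fun i _ ↦ (hU i).1
  refine ⟨((hbase n).1.union hfinU).subset hsub, ?_⟩
  have hcardU : ((⋃ i ∈ s, U i).ncard : ℝ) ≤ n * B n * z ^ n := by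
    have h1 : ((⋃ i ∈ s, U i).ncard : ℝ) ≤ ∑ i ∈ s, ((U i).ncard : ℝ) := by
      exact_mod_cast Finset.set_ncard_biUnion_le s U
    refine (h1.trans (Finset.sum_le_sum fun i _ ↦ (hU i).2)).trans ?_
    rw [← Finset.mul_sum]
    exact mul_le_of_le_one_right (by positivity) hs
  have h2 : ((f n).ncard : ℝ) ≤ (base n).ncard + (⋃ i ∈ s, U i).ncard := by
    exact_mod_cast (Set.ncard_le_ncard hsub ((hbase n).1.union hfinU)).trans
      (Set.ncard_union_le _ _)
  have h3 : ((base n).ncard : ℝ) ≤ B n * z ^ n :=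
    (Nat.cast_le.mpr (hbase n).2).trans
      (le_mul_of_one_le_right (Nat.cast_nonneg _) (one_le_pow₀ hz))
  linarith

/-- The terminal shape a^c t a^e is there for non-adjacent forms: a nonzero digit uses up two
letters t, and the string may have only one left. -/
theorem growthRate_le_of_recursion {a t : G}
    (hcomm : ∀ i : ℕ, Commute (t ^ i * a * (t ^ i)⁻¹) a) {ι : Type*} (s : Finset ι) (w : ι → G)
    (ℓ : ι → ℕ) (hℓ : ∀ i, 1 ≤ ℓ i)
    (hf : ∀ n, ∀ g ∈ digitSet a t n,
      (∃ c e : ℤ, c.natAbs ≤ n ∧ e.natAbs ≤ n ∧ (g = a ^ e ∨ g = a ^ c * t * a ^ e)) ∨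
      ∃ i ∈ s, ℓ i ≤ n ∧ ∃ h ∈ digitSet a t (n - ℓ i), g = w i * h)
    {z : ℝ} (hz : 1 ≤ z) (hs : ∑ i ∈ s, (z⁻¹) ^ ℓ i ≤ 1) :
    growthRate {a, t} ≤ z := by
  set base : ℕ → Set G := fun n ↦
    {g | ∃ c e : ℤ, c.natAbs ≤ n ∧ e.natAbs ≤ n ∧ (g = a ^ e ∨ g = a ^ c * t * a ^ e)}
  have hbase : ∀ n, (base n).Finite ∧ (base n).ncard ≤ 8 * (n + 1) ^ 2 := by
    intro n
    set P : Finset (ℤ × ℤ) := Finset.Icc (-n : ℤ) n ×ˢ Finset.Icc (-n : ℤ) n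
    have hsub : base n ⊆ (fun x : ℤ × ℤ ↦ a ^ x.2) '' (P : Set (ℤ × ℤ)) ∪
        (fun x : ℤ × ℤ ↦ a ^ x.1 * t * a ^ x.2) '' (P : Set (ℤ × ℤ)) := by
      rintro g ⟨c, e, hc, he, h⟩
      have hce : (c, e) ∈ (P : Set (ℤ × ℤ)) := by
        simp only [P, Finset.coe_product, Set.mem_prod, Finset.coe_Icc, Set.mem_Icc]
        omega
      exact h.imp (fun h ↦ ⟨_, hce, h.symm⟩) fun h ↦ ⟨_, hce, h.symm⟩
    have hP : P.card ≤ 4 * (n + 1) ^ 2 := by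
      rw [Finset.card_product, Int.card_Icc]
      have : ((n : ℤ) + 1 - -n).toNat = 2 * n + 1 := by omega
      rw [this]
      nlinarith
    have hfin := (P.finite_toSet.image fun x : ℤ × ℤ ↦ a ^ x.2).union
      (P.finite_toSet.image fun x : ℤ × ℤ ↦ a ^ x.1 * t * a ^ x.2)
    refine ⟨hfin.subset hsub, (Set.ncard_le_ncard hsub hfin).trans
      ((Set.ncard_union_le _ _).trans ?_)⟩
    have h1 := Set.ncard_image_le (f := fun x : ℤ × ℤ ↦ a ^ x.2) P.finite_toSet
    have h2 := Set.ncard_image_le (f := fun x : ℤ × ℤ ↦ a ^ x.1 * t * a ^ x.2) P.finite_toSet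
    rw [Set.ncard_coe_finset] at h1 h2
    linarith
  have hcount := ncard_le_of_recursion s w ℓ hℓ (digitSet a t) base (fun n ↦ 8 * (n + 1) ^ 2)
    (fun m n h ↦ by dsimp only; gcongr) hbase hf hz hs
  refine growthRate_le (by simp) (C := 16) (by positivity) 5 fun n ↦ ?_
  obtain ⟨hfin, hle⟩ := hcount n
  have h1 : (growthFunction {a, t} n : ℝ) ≤
      ((n : ℝ) + 1) * (2 * n + 1) * (digitSet a t n).ncard := by
    exact_mod_cast growthFunction_le_digitSet hcomm n hfin
  refine h1.trans ?_
  calc ((n : ℝ) + 1) * (2 * n + 1) * (digitSet a t n).ncard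
      ≤ ((n : ℝ) + 1) * (2 * (n + 1)) * ((n + 1) * ((8 * (n + 1) ^ 2 : ℕ) : ℝ) * z ^ n) := by
        gcongr
        linarith
    _ = 16 * ((n : ℝ) + 1) ^ 5 * z ^ n := by push_cast; ring

/-- The upper bound for the growth rate if powers of `a` reduce to digits in `s`, possibly with a
carry. -/
theorem growthRate_le_of_digits {a t : G}
    (hcomm : ∀ i : ℕ, Commute (t ^ i * a * (t ^ i)⁻¹) a) (s : Finset ℤ)
    (hred : ∀ c : ℤ, ∃ i ∈ s, ∃ q : ℤ, a ^ c * t = a ^ i * t * a ^ q ∧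
      i.natAbs + q.natAbs ≤ c.natAbs)
    {z : ℝ} (hz : 1 ≤ z) (hs : ∑ i ∈ s, (z⁻¹) ^ (i.natAbs + 1) ≤ 1) :
    growthRate {a, t} ≤ z := by
  refine growthRate_le_of_recursion hcomm s (fun i ↦ a ^ i * t) (fun i ↦ i.natAbs + 1)
    (fun i ↦ by omega) (fun n g hg ↦ ?_) hz hs
  obtain ⟨L, hL⟩ := hg
  cases hL with
  | base e _ h => exact .inl ⟨0, e, by simp, h, .inl rfl⟩
  | @step c L m n g hg h =>
    obtain ⟨i, hi, q, he, hq⟩ := hred c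
    refine .inr ⟨i, hi, by omega, a ^ q * g, ⟨L, (hg.zpow_mul q).mono (by omega)⟩, ?_⟩
    rw [he, mul_assoc _ (a ^ q)]

/-- The upper bound for the growth rate if `t * a * t⁻¹ = a ^ 2`, by non-adjacent forms. -/
theorem growthRate_le_of_nonadjacent {a t : G} (hrel : ∀ q : ℤ, a ^ (2 * q) * t = t * a ^ q)
    (hcomm : ∀ i : ℕ, Commute (t ^ i * a * (t ^ i)⁻¹) a)
    {z : ℝ} (hz : 1 ≤ z) (hs : z⁻¹ + 2 * z⁻¹ ^ 3 ≤ 1) :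
    growthRate {a, t} ≤ z := by
  refine growthRate_le_of_recursion hcomm ({-1, 0, 1} : Finset ℤ)
    (fun i ↦ if i = 0 then t else a ^ i * t * t) (fun i ↦ if i = 0 then 1 else 3)
    (fun i ↦ by split_ifs <;> omega) (fun n g hg ↦ ?_) hz ?_
  · obtain ⟨L, hL⟩ := hg
    cases hL with
    | base e _ h => exact .inl ⟨0, e, by simp, h, .inl rfl⟩
    | @step c L m n g hg h =>
    rcases Int.even_or_odd' c with ⟨q, rfl | hc⟩
    · refine .inr ⟨0, by simp, by simp; omega, a ^ q * g,
        ⟨L, (hg.zpow_mul q).mono (by simp; omega)⟩, ?_⟩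
      simp [hrel, mul_assoc]
    · cases hg with
      | base e _ h' => exact .inl ⟨c, e, by omega, by omega, .inr rfl⟩
      | @step c' L m' n g hg h' =>
      -- The sign of the odd digit i = ±1 is chosen so that the carry makes the next digit even,
      -- that is, zero after a further carry r. The bound on r says that the rewriting costs
      -- nothing.
      obtain ⟨i, q', r, hi, h1, h2, h3⟩ : ∃ i q' r : ℤ, (i = 1 ∨ i = -1) ∧ c = i + 2 * q' ∧
          q' + c' = 2 * r ∧ r.natAbs + 1 ≤ c.natAbs + c'.natAbs := by
        rcases Int.even_or_odd' (q + c') with ⟨r, hr | hr⟩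
        · exact ⟨1, q, r, .inl rfl, by omega, hr, by omega⟩
        · exact ⟨-1, q + 1, r + 1, .inr rfl, by omega, by omega, by omega⟩
      have hi0 : i ≠ 0 := by omega
      refine .inr ⟨i, by simp; omega, by rw [if_neg hi0]; omega, a ^ r * g,
        ⟨L, (hg.zpow_mul r).mono (by rw [if_neg hi0]; omega)⟩, ?_⟩
      rw [if_neg hi0]
      calc a ^ c * t * (a ^ c' * t * g) = a ^ i * (a ^ (2 * q') * t) * (a ^ c' * t * g) := by
            rw [h1, zpow_add]; group
        _ = a ^ i * t * (a ^ (q' + c') * t) * g := by rw [hrel, zpow_add]; group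
        _ = a ^ i * t * t * (a ^ r * g) := by rw [h2, hrel]; group
  · rw [Finset.sum_insert (by simp), Finset.sum_insert (by simp), Finset.sum_singleton]
    norm_num
    rw [← inv_pow]
    linarith

/-! ### Leading terms in powers of π -/

/-- The uniformizer-like element `π` of the subring `O`: an integer that is divisible by `π` in `O`
is divisible by `p`. -/
structure IsDigitBase {K : Type*} [Field K] (p : ℕ) (O : Subring K) (π : K) : Prop where
  mem : π ∈ O
  ne_zero : π ≠ 0
  not_dvd_one : ¬ (p : ℤ) ∣ 1
  dvd : ∀ c : ℤ, ∀ w ∈ O, (c : K) = π * w → (p : ℤ) ∣ c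

namespace IsDigitBase

variable {K : Type*} [Field K] {p : ℕ} {O : Subring K} {π : K}

theorem zpow_mem (hb : IsDigitBase p O π) {n : ℤ} (hn : 0 ≤ n) : π ^ n ∈ O := by
  lift n to ℕ using hn
  simpa using pow_mem hb.mem n

theorem zpow_eq_mul (hb : IsDigitBase p O π) (n : ℤ) : π ^ n = π * π ^ (n - 1) := by
  rw [← zpow_one_add₀ hb.ne_zero]
  congr 1
  ring

theorem eq_zero_of_zpow_eq_one (hb : IsDigitBase p O π) {n : ℤ} (h : π ^ n = 1) : n = 0 := by
  have key : ∀ n : ℤ, 0 < n → π ^ n ≠ 1 := fun n hn h ↦ hb.not_dvd_one <|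
    hb.dvd 1 (π ^ (n - 1)) (hb.zpow_mem (by omega)) (by rw [← hb.zpow_eq_mul, h]; simp)
  rcases lt_trichotomy n 0 with hn | hn | hn
  · exact absurd (by rw [zpow_neg, h, inv_one]) (key (-n) (by omega))
  · exact hn
  · exact absurd h (key n hn)

/-- If e < e', dividing by π ^ e exhibits c as an element of πO. -/
theorem not_lt_of_lead_eq (hb : IsDigitBase p O π) {e e' c c' : ℤ} {w w' : K} (hw : w ∈ O)
    (hw' : w' ∈ O)
    (hc : ¬ (p : ℤ) ∣ c) (h : π ^ e * (c + π * w) = π ^ e' * (c' + π * w')) : ¬ e < e' := by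
  intro hlt
  refine hc (hb.dvd c (π ^ (e' - e - 1) * (c' + π * w') - w) ?_ ?_)
  · exact sub_mem (mul_mem (hb.zpow_mem (by omega))
      (add_mem (intCast_mem O _) (mul_mem hb.mem hw'))) hw
  · have h0 := zpow_ne_zero e hb.ne_zero
    have h1 : π ^ e' = π ^ e * (π * π ^ (e' - e - 1)) := by
      rw [← hb.zpow_eq_mul, ← zpow_add₀ hb.ne_zero]
      congr 1
      ring
    rw [h1, mul_assoc (π ^ e)] at h
    linear_combination mul_left_cancel₀ h0 h

/-- Leading exponents and leading coefficients are well defined. -/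
theorem lead_eq (hb : IsDigitBase p O π) {e e' c c' : ℤ} {w w' : K} (hw : w ∈ O) (hw' : w' ∈ O)
    (hc : ¬ (p : ℤ) ∣ c) (hc' : ¬ (p : ℤ) ∣ c')
    (h : π ^ e * (c + π * w) = π ^ e' * (c' + π * w')) : e = e' ∧ (p : ℤ) ∣ c - c' := by
  have h1 := hb.not_lt_of_lead_eq hw hw' hc h
  have h2 := hb.not_lt_of_lead_eq hw' hw hc' h.symm
  obtain rfl : e = e' := by omega
  refine ⟨rfl, hb.dvd _ (w' - w) (sub_mem hw' hw) ?_⟩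
  push_cast
  linear_combination mul_left_cancel₀ (zpow_ne_zero e hb.ne_zero) h

end IsDigitBase

theorem map_mul_apply {α : Type*} (φ : G →* Equiv.Perm α) (g h : G) (u : α) :
    φ (g * h) u = φ g (φ h u) := by
  rw [map_mul, Equiv.Perm.mul_apply]

theorem map_inv_apply_of_eq {α : Type*} {φ : G →* Equiv.Perm α} {g : G} {u v : α} (h : φ g v = u) :
    φ g⁻¹ u = v := by
  rw [map_inv, Equiv.Perm.inv_eq_iff_eq, h]

/-! ### Ping-pong with digits and free semigroups -/

section Normalized

variable {K : Type*} [Field K] {p : ℕ} {O : Subring K} {π : K}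
  {φ : G →* Equiv.Perm K} {S : Set G}

theorem map_zpow_apply_of_mul {x : G} {c : K} (hc : c ≠ 0) (hx : ∀ u, φ x u = c * u) (i : ℤ)
    (u : K) :
    φ (x ^ i) u = c ^ i * u := by
  have hn : ∀ (n : ℕ) u, φ (x ^ n) u = c ^ n * u := fun n ↦ by
    induction n with
    | zero => simp
    | succ n ih => intro u; rw [pow_succ, map_mul, Equiv.Perm.mul_apply, ih, hx]; ring
  obtain ⟨n, rfl | rfl⟩ := i.eq_nat_or_neg
  · simpa using hn n u
  · rw [zpow_neg, zpow_natCast, zpow_neg, zpow_natCast]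
    refine map_inv_apply_of_eq ?_
    rw [hn]
    field_simp

theorem map_zpow_apply_of_add {y : G} (hy : ∀ u, φ y u = u + 1) (i : ℤ) (u : K) :
    φ (y ^ i) u = u + i := by
  have hn : ∀ (n : ℕ) u, φ (y ^ n) u = u + n := fun n ↦ by
    induction n with
    | zero => simp
    | succ n ih => intro u; rw [pow_succ, map_mul, Equiv.Perm.mul_apply, ih, hy]; push_cast; ring
  obtain ⟨n, rfl | rfl⟩ := i.eq_nat_or_neg
  · simpa using hn n u
  · rw [zpow_neg, zpow_natCast]
    refine map_inv_apply_of_eq ?_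
    rw [hn]
    push_cast
    ring

/-- Words acting as `u ↦ π ^ h * u + i` for digits `i ∈ s` play ping-pong. -/
theorem inv_le_growthRate_of_digitWords (hb : IsDigitBase p O π) (hS : S.Finite)
    (s : Finset ℤ)
    (hs : ∀ i ∈ s, ∀ j ∈ s, (p : ℤ) ∣ i - j → i = j) {h : ℤ} (hh : 0 < h) (w : ℤ → G) (ℓ : ℤ → ℕ)
    (hφ : ∀ i u, φ (w i) u = π ^ h * u + i) (hw : ∀ i, w i ∈ ball S (ℓ i)) (hℓ : ∀ i, 1 ≤ ℓ i)
    {x : ℝ} (hx : 0 < x) (hsum : 1 ≤ ∑ i ∈ s, x ^ ℓ i) : x⁻¹ ≤ growthRate S := by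
  refine inv_le_growthRate_of_pingPong φ (fun i : s ↦ w i) (X := (O : Set K)) hS Finset.univ
    (ℓ := fun i ↦ ℓ i) (fun i ↦ hw i) (fun i ↦ hℓ i) ⟨0, O.zero_mem⟩ (fun i u hu ↦ ?_)
    (fun i j u hu u' hu' huu ↦ ?_) hx ?_
  · rw [hφ]
    exact add_mem (mul_mem (hb.zpow_mem hh.le) hu) (intCast_mem O _)
  · refine Subtype.ext (hs i i.2 j j.2 (hb.dvd _ (π ^ (h - 1) * (u' - u)) ?_ ?_))
    · exact mul_mem (hb.zpow_mem (by omega)) (sub_mem hu' hu)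
    · rw [hφ, hφ] at huu
      rw [← mul_assoc, ← hb.zpow_eq_mul]
      push_cast
      linear_combination huu
  · rwa [Finset.sum_coe_sort s fun i ↦ x ^ ℓ i]

/-- Two elements contracting to distinct points generate a free semigroup. -/
theorem two_le_growthRate (hb : IsDigitBase p O π) (hS : S.Finite)
    {h h' : ℤ} (hh : 0 < h) (hh' : 0 < h') {x y : G}
    (hxS : x ∈ S ∨ x⁻¹ ∈ S) (hyS : y ∈ S ∨ y⁻¹ ∈ S)
    (hx : ∀ u, φ x u = π ^ h * u) (hy : ∀ u, φ y u = π ^ h' * u + 1) : 2 ≤ growthRate S := by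
  have key : ∀ u ∈ O, ∀ u' ∈ O, π ^ h * u ≠ π ^ h' * u' + 1 := fun u hu u' hu' huu ↦
    hb.not_dvd_one <| hb.dvd _ (π ^ (h - 1) * u - π ^ (h' - 1) * u')
      (sub_mem (mul_mem (hb.zpow_mem (by omega)) hu) (mul_mem (hb.zpow_mem (by omega)) hu')) <| by
    rw [mul_sub, ← mul_assoc, ← mul_assoc, ← hb.zpow_eq_mul, ← hb.zpow_eq_mul]
    push_cast
    linear_combination -huu
  rw [← inv_inv (2 : ℝ)]
  refine inv_le_growthRate_of_pingPong φ (fun i : Bool ↦ if i then x else y) (X := (O : Set K)) hS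
    Finset.univ (ℓ := fun _ ↦ 1) (fun i ↦ ?_) (fun i ↦ le_rfl) ⟨0, O.zero_mem⟩ (fun i u hu ↦ ?_)
    (fun i j u hu u' hu' huu ↦ ?_) (by norm_num) (by norm_num)
  · cases i
    · exact mem_ball_one hyS
    · exact mem_ball_one hxS
  · cases i
    · simpa [hy] using add_mem (mul_mem (hb.zpow_mem hh'.le) hu) O.one_mem
    · simpa [hx] using mul_mem (hb.zpow_mem hh.le) hu
  · cases i <;> cases j <;> simp only [Bool.false_eq_true, if_false, if_true, hx, hy] at huu
    · rfl
    · exact (key _ hu' _ hu huu.symm).elim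
    · exact (key _ hu _ hu' huu).elim
    · rfl

/-- Non-adjacent forms are unique if `4` does not divide `2`. -/
theorem inv_le_growthRate_of_nonadjacent (hb : IsDigitBase p O π) (hS : S.Finite)
    (htwo : ∀ w ∈ O, (2 : K) ≠ π ^ 2 * w) {h : ℤ} (hh : 0 < h)
    {x y : G} (hxS : x ∈ S ∨ x⁻¹ ∈ S) (hyS : y ∈ S ∨ y⁻¹ ∈ S)
    (hx : ∀ u, φ x u = π ^ h * u) (hy : ∀ u, φ y u = u + 1)
    {r : ℝ} (hr : 0 < r) (hsum : 1 ≤ r + 2 * r ^ 3) : r⁻¹ ≤ growthRate S := by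
  set e : ℤ → ℤ := fun i ↦ if i = 0 then h else h + h
  set w : ℤ → G := fun i ↦ if i = 0 then x else y ^ i * (x * x)
  have hφ : ∀ i u, φ (w i) u = π ^ e i * u + i := by
    intro i u
    by_cases hi : i = 0
    · simp [w, e, hi, hx]
    · simp only [w, e, if_neg hi, map_mul, Equiv.Perm.mul_apply, hx, map_zpow_apply_of_add hy,
        zpow_add₀ hb.ne_zero]
      ring
  have he : ∀ i, 0 < e i := fun i ↦ by simp only [e]; split_ifs <;> omega
  set s : Finset ℤ := {-1, 0, 1}
  refine inv_le_growthRate_of_pingPong φ (fun i : s ↦ w i) (X := (O : Set K)) hS Finset.univ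
    (ℓ := fun i ↦ if (i : ℤ) = 0 then 1 else 3) (fun i ↦ ?_) (fun i ↦ by split_ifs <;> omega)
    ⟨0, O.zero_mem⟩ (fun i u hu ↦ ?_) (fun i j u hu u' hu' huu ↦ ?_) hr ?_
  · by_cases hi : (i : ℤ) = 0
    · simpa [w, hi] using mem_ball_one hxS
    · simp only [w, if_neg hi]
      have h1 : (i : ℤ).natAbs = 1 := by
        have := i.2
        simp only [s, Finset.mem_insert, Finset.mem_singleton] at this
        omega
      have := mul_mem_ball (zpow_mem_ball hyS i) (mul_mem_ball (mem_ball_one hxS) (mem_ball_one hxS))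
      rwa [h1] at this
  · rw [hφ]
    exact add_mem (mul_mem (hb.zpow_mem (he _).le) hu) (intCast_mem O _)
  · rw [hφ, hφ] at huu
    have hdvd : (p : ℤ) ∣ (i - j : ℤ) := by
      refine hb.dvd _ (π ^ (e j - 1) * u' - π ^ (e i - 1) * u) ?_ ?_
      · have h1 := he i
        have h2 := he j
        exact sub_mem (mul_mem (hb.zpow_mem (by omega)) hu') (mul_mem (hb.zpow_mem (by omega)) hu)
      · rw [mul_sub, ← mul_assoc, ← mul_assoc, ← hb.zpow_eq_mul, ← hb.zpow_eq_mul]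
        push_cast
        linear_combination huu
    have hπ : π ^ (h + h) = π ^ 2 * π ^ (h + h - 2) := by
      rw [← zpow_natCast, ← zpow_add₀ hb.ne_zero]
      congr 1
      push_cast
      ring
    have hmem : π ^ (h + h - 2) ∈ O := hb.zpow_mem (by omega)
    have hone := hb.not_dvd_one
    have hone' : ¬ (p : ℤ) ∣ -1 := by rwa [Int.dvd_neg]
    have hi := i.2
    have hj := j.2
    simp only [s, Finset.mem_insert, Finset.mem_singleton] at hi hj
    refine Subtype.ext ?_
    -- Divisibility by p leaves only the pairs with equal digits and the pairs 1, -1. In the latter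
    -- both words scale by π^(2h), so 2 would lie in π²O.
    rcases hi with hi | hi | hi <;> rcases hj with hj | hj | hj <;> rw [hi, hj] at hdvd huu ⊢ <;>
      norm_num at hdvd <;> try contradiction
    · refine absurd ?_ (htwo _ (mul_mem hmem (sub_mem hu hu')))
      norm_num [e, hπ] at huu
      linear_combination -huu
    · refine absurd ?_ (htwo _ (mul_mem hmem (sub_mem hu' hu)))
      norm_num [e, hπ] at huu
      linear_combination huu
  · rw [Finset.sum_coe_sort s fun i ↦ r ^ (if i = 0 then 1 else 3)]
    simp only [s]
    rw [Finset.sum_insert (by simp), Finset.sum_insert (by simp), Finset.sum_singleton]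
    norm_num
    linarith

end Normalized

/-! ### Two contractions of different strength -/

theorem tendsto_sum_range_pow_add {x : ℝ} (hx0 : 0 ≤ x) (hx1 : x < 1) (a : ℕ) :
    Tendsto (fun M ↦ ∑ i ∈ Finset.range M, x ^ (i + a)) atTop (𝓝 (x ^ a / (1 - x))) := by
  have := ((hasSum_geometric_of_lt_one hx0 hx1).mul_right (x ^ a)).tendsto_sum_nat
  simpa only [pow_add, div_eq_inv_mul] using this

section Hyperbolic

variable {K : Type*} [Field K] {p : ℕ} {O : Subring K} {π : K}
  {φ : G →* Equiv.Perm K} {S : Set G} {h₁ h₂ : ℤ} {x y : G}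

theorem map_zpow_apply (hb : IsDigitBase p O π) (hx : ∀ u, φ x u = π ^ h₁ * u)
    (i : ℤ) (u : K) : φ (x ^ i) u = π ^ (i * h₁) * u := by
  rw [map_zpow_apply_of_mul (zpow_ne_zero h₁ hb.ne_zero) hx, ← zpow_mul, mul_comm h₁]

/-- On the ping-pong set X = π^(1-h₂) O, the map y turns the argument into an element of πO and adds
1, so 1 is the leading term. -/
theorem map_zpow_mul_apply (hb : IsDigitBase p O π) (hx : ∀ u, φ x u = π ^ h₁ * u)
    (hy : ∀ u, φ y u = π ^ h₂ * u + 1) (i : ℤ) {w : K} :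
    φ (x ^ i * y) (π ^ (1 - h₂) * w) = π ^ (i * h₁) * (1 + π * w) := by
  have h1 : π ^ h₂ * (π ^ (1 - h₂) * w) = π * w := by
    rw [← mul_assoc, ← zpow_add₀ hb.ne_zero]
    simp
  rw [map_mul_apply, hy, map_zpow_apply hb hx, h1]
  ring

/-- The right half x^(g'+1) y sends X into πO because h₁ > 0 and the exponent of x is positive.
There y⁻¹ subtracts 1 before it scales, whence the leading coefficient -1. -/
theorem map_zpow_mul_inv_apply (hb : IsDigitBase p O π) (hx : ∀ u, φ x u = π ^ h₁ * u)
    (hy : ∀ u, φ y u = π ^ h₂ * u + 1) (hh₁ : 0 < h₁) (g g' : ℕ) {w : K} (hw : w ∈ O) :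
    ∃ w' ∈ O, φ (x ^ (g + 1 : ℤ) * y⁻¹ * (x ^ (g' + 1 : ℤ) * y)) (π ^ (1 - h₂) * w) =
      π ^ ((g + 1 : ℤ) * h₁ - h₂) * (-1 + π * w') := by
  have hpos : 0 ≤ ((g' : ℤ) + 1) * h₁ - 1 := by
    have : 0 < ((g' : ℤ) + 1) * h₁ := by positivity
    omega
  refine ⟨π ^ ((g' + 1 : ℤ) * h₁ - 1) * (1 + π * w), mul_mem (hb.zpow_mem hpos)
    (add_mem O.one_mem (mul_mem hb.mem hw)), ?_⟩
  have hinv : ∀ u, φ y⁻¹ u = π ^ (-h₂) * (u - 1) := fun u ↦ map_inv_apply_of_eq <| by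
    rw [hy, ← mul_assoc, ← zpow_add₀ hb.ne_zero]
    simp
  rw [map_mul_apply, map_zpow_mul_apply hb hx hy, map_mul_apply, hinv, map_zpow_apply hb hx,
    ← mul_assoc π, ← hb.zpow_eq_mul, sub_eq_add_neg (_ * h₁),
    zpow_add₀ hb.ne_zero]
  ring

/-- The words `x ^ i * y` for `i ≥ -1` and `x ^ g * y⁻¹ * x ^ g' * y` for `g, g' ≥ 1` play
ping-pong, together with any family of words `v j` with other leading terms. -/
theorem inv_le_growthRate_of_family (hb : IsDigitBase p O π) (hx : ∀ u, φ x u = π ^ h₁ * u)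
    (hy : ∀ u, φ y u = π ^ h₂ * u + 1) (hS : S.Finite) (hp : ¬ (p : ℤ) ∣ 2) (hh₁ : 0 < h₁)
    (hh : h₁ < h₂) (hxS : x ∈ S ∨ x⁻¹ ∈ S) (hyS : y ∈ S ∨ y⁻¹ ∈ S)
    {ε : Type*} (v : ε → G) (ℓ : ε → ℕ) (hv : ∀ j, v j ∈ ball S (ℓ j)) (hℓ : ∀ j, 1 ≤ ℓ j)
    (e c : ε → ℤ)
    (hlead : ∀ j, ∀ w ∈ O, ∃ w' ∈ O, φ (v j) (π ^ (1 - h₂) * w) = π ^ e j * (c j + π * w'))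
    (he : ∀ j, 1 - h₂ ≤ e j) (hc : ∀ j, ¬ (p : ℤ) ∣ c j) (hc1 : ∀ j, ¬ (p : ℤ) ∣ c j + 1)
    (hA : ∀ j, ∀ i : ℤ, -1 ≤ i → e j = i * h₁ → ¬ (p : ℤ) ∣ c j - 1)
    (hvv : ∀ j j', ∀ w ∈ O, ∀ w' ∈ O,
      φ (v j) (π ^ (1 - h₂) * w) = φ (v j') (π ^ (1 - h₂) * w') → j = j')
    {r : ℝ} (hr : 0 < r) (M : ℕ) (E : Finset ε)
    (hsum : 1 ≤ ∑ i ∈ Finset.range M, r ^ (i + 1) + r ^ 2 +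
      (∑ i ∈ Finset.range M, r ^ (i + 2)) ^ 2 + ∑ j ∈ E, r ^ ℓ j) : r⁻¹ ≤ growthRate S := by
  set W : (ℕ ⊕ ℕ × ℕ) ⊕ ε → G := Sum.elim (Sum.elim (fun i ↦ x ^ (i - 1 : ℤ) * y)
    fun g ↦ x ^ (g.1 + 1 : ℤ) * y⁻¹ * (x ^ (g.2 + 1 : ℤ) * y)) v
  set len : (ℕ ⊕ ℕ × ℕ) ⊕ ε → ℕ := Sum.elim (Sum.elim (fun i ↦ (i - 1 : ℤ).natAbs + 1)
    fun g ↦ (g.1 + 1 + 1) + (g.2 + 1 + 1)) ℓ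
  set ex : (ℕ ⊕ ℕ × ℕ) ⊕ ε → ℤ := Sum.elim (Sum.elim (fun i ↦ (i - 1 : ℤ) * h₁)
    fun g ↦ (g.1 + 1 : ℤ) * h₁ - h₂) e
  set co : (ℕ ⊕ ℕ × ℕ) ⊕ ε → ℤ := Sum.elim (Sum.elim (fun _ ↦ 1) fun _ ↦ -1) c
  -- This is y⁻¹-friendly room: it contains every element with leading exponent at least 1 - h₂, so
  -- h₁ < h₂ already allows x⁻¹y.
  set X : Set K := {u | ∃ w ∈ O, u = π ^ (1 - h₂) * w}
  have hone := hb.not_dvd_one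
  have hlead' : ∀ i, ∀ u ∈ X, ∃ w ∈ O, φ (W i) u = π ^ ex i * (co i + π * w) := by
    rintro ((i | ⟨g, g'⟩) | j) _ ⟨w, hw, rfl⟩
    · exact ⟨w, hw, by simpa [W, ex, co] using map_zpow_mul_apply hb hx hy (i - 1) (w := w)⟩
    · simpa [W, ex, co] using map_zpow_mul_inv_apply hb hx hy hh₁ g g' hw
    · exact hlead j w hw
  have hco : ∀ i, ¬ (p : ℤ) ∣ co i := by
    rintro ((i | ⟨g, g'⟩) | j)
    · exact hone
    · simpa [co] using hone
    · exact hc j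
  have hex : ∀ i, 1 - h₂ ≤ ex i := by
    rintro ((i | ⟨g, g'⟩) | j)
    · simp only [ex, Sum.elim_inl]
      nlinarith [Int.natCast_nonneg i]
    · simp only [ex, Sum.elim_inl, Sum.elim_inr]
      nlinarith [Int.natCast_nonneg g]
    · exact he j
  have hcancel : ∀ i j : ℤ, i * h₁ = j * h₁ → i = j := fun i j h ↦
    mul_right_cancel₀ hh₁.ne' h
  refine inv_le_growthRate_of_pingPong φ W (X := X) hS
    (((Finset.range (M + 1)).disjSum (Finset.range M ×ˢ Finset.range M)).disjSum E)
    (ℓ := len) ?_ ?_ ⟨0, 0, O.zero_mem, by simp⟩ (fun i u hu ↦ ?_)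
    (fun i j u hu u' hu' huu ↦ ?_) hr ?_
  · rintro ((i | ⟨g, g'⟩) | j)
    · exact mul_mem_ball (zpow_mem_ball hxS _) (mem_ball_one hyS)
    · have hy' : y⁻¹ ∈ S ∨ y⁻¹⁻¹ ∈ S := by rw [inv_inv]; exact hyS.symm
      exact mul_mem_ball (mul_mem_ball (zpow_mem_ball hxS (g + 1 : ℕ)) (mem_ball_one hy'))
        (mul_mem_ball (zpow_mem_ball hxS (g' + 1 : ℕ)) (mem_ball_one hyS))
    · exact hv j
  · rintro ((i | ⟨g, g'⟩) | j)
    · simp [len]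
    · simp only [len, Sum.elim_inl, Sum.elim_inr]; omega
    · exact hℓ j
  · obtain ⟨w, hw, h⟩ := hlead' i u hu
    refine ⟨π ^ (ex i - (1 - h₂)) * (co i + π * w), mul_mem (hb.zpow_mem ?_)
      (add_mem (intCast_mem O _) (mul_mem hb.mem hw)), ?_⟩
    · have := hex i; omega
    · rw [h, ← mul_assoc, ← zpow_add₀ hb.ne_zero]
      congr 2
      ring
  · obtain ⟨w, hw, h⟩ := hlead' i u hu
    obtain ⟨w', hw', h'⟩ := hlead' j u' hu'
    obtain ⟨h1, h2⟩ := hb.lead_eq hw hw' (hco i) (hco j) (by rw [← h, ← h', huu])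
    rcases i with (i | ⟨g, g'⟩) | i <;> rcases j with (j | ⟨k, k'⟩) | j <;>
      simp only [ex, co, Sum.elim_inl, Sum.elim_inr] at h1 h2
    · have := hcancel _ _ h1
      congr 2
      omega
    · exact absurd h2 hp
    · refine absurd ?_ (hA j (i - 1) (by omega) h1.symm)
      rwa [← dvd_neg, neg_sub]
    · refine absurd ?_ hp
      rw [← dvd_neg]
      exact h2
    -- The leading exponent sees only g. After the common prefix is cancelled, the leading exponent
    -- of the rest determines g'.
    · have h3 := hcancel (g + 1) (k + 1) (by linarith)
      obtain rfl : g = k := by omega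
      simp only [W, Sum.elim_inl, Sum.elim_inr] at huu
      rw [map_mul_apply, map_mul_apply φ (_ * y⁻¹), EmbeddingLike.apply_eq_iff_eq] at huu
      obtain ⟨v, hv, rfl⟩ := hu
      obtain ⟨v', hv', rfl⟩ := hu'
      rw [map_zpow_mul_apply hb hx hy, map_zpow_mul_apply hb hx hy] at huu
      have h4 := (hb.lead_eq (c := 1) (c' := 1) hv hv' hone hone (by simpa using huu)).1
      have h5 := hcancel _ _ h4
      obtain rfl : g' = k' := by omega
      rfl
    · refine absurd ?_ (hc1 j)
      rw [← dvd_neg]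
      rwa [neg_add_rev, ← sub_eq_add_neg]
    · exact absurd h2 (hA i (j - 1) (by omega) h1)
    · refine absurd ?_ (hc1 i)
      simpa using h2
    · obtain ⟨v, hv, rfl⟩ := hu
      obtain ⟨v', hv', rfl⟩ := hu'
      rw [hvv i j v hv v' hv' huu]
  -- Splitting off index 0 isolates the word x⁻¹y, of length 2, which accounts for the summand r ^
  -- 2.
  · rw [Finset.sum_disjSum, Finset.sum_disjSum, Finset.sum_range_succ', Finset.sum_product]
    have h1 : ∑ g ∈ Finset.range M, ∑ g' ∈ Finset.range M, r ^ len (.inl (.inr (g, g'))) =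
        (∑ i ∈ Finset.range M, r ^ (i + 2)) ^ 2 := by
      rw [sq, Finset.sum_mul_sum]
      refine Finset.sum_congr rfl fun i _ ↦ Finset.sum_congr rfl fun j _ ↦ ?_
      rw [← pow_add]
      rfl
    have h2 : ∑ i ∈ Finset.range M, r ^ len (.inl (.inl (i + 1))) =
        ∑ i ∈ Finset.range M, r ^ (i + 1) := by
      simp [len]
    rw [h1, h2]
    simpa [len] using hsum

/-- Here -2h₁ ≥ 1 - h₂, so X has room for the further word x⁻²y of length 3, and the extra r ^ 3
lifts the generating function above 1. -/
theorem inv_le_growthRate_of_two_mul_lt (hb : IsDigitBase p O π) (hx : ∀ u, φ x u = π ^ h₁ * u)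
    (hy : ∀ u, φ y u = π ^ h₂ * u + 1) (hS : S.Finite) (hp : ¬ (p : ℤ) ∣ 2) (hh₁ : 0 < h₁)
    (hh : 2 * h₁ < h₂) (hxS : x ∈ S ∨ x⁻¹ ∈ S) (hyS : y ∈ S ∨ y⁻¹ ∈ S)
    {r : ℝ} (hr : 0 < r) (hr1 : r < 1) (hr2 : 1 < r ^ 2 + 2 * r) : r⁻¹ ≤ growthRate S := by
  have hlim := (((tendsto_sum_range_pow_add hr.le hr1 1).add_const (r ^ 2)).add
    ((tendsto_sum_range_pow_add hr.le hr1 2).pow 2)).add_const (r ^ 3)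
  have hgt : 1 < r ^ 1 / (1 - r) + r ^ 2 + (r ^ 2 / (1 - r)) ^ 2 + r ^ 3 := by
    have h1 : 0 < 1 - r := by linarith
    have h2 : r ^ 1 / (1 - r) + r ^ 2 + (r ^ 2 / (1 - r)) ^ 2 + r ^ 3 - 1 =
        (r ^ 5 - r ^ 3 - r ^ 2 + 3 * r - 1) / (1 - r) ^ 2 := by
      field_simp
      ring
    -- The hypothesis says r > √2 - 1 = 0.4142…, and 0.012 below is a lower bound for 0.414 ^ 5.
    have h3 : 0.414 < r := by nlinarith
    have h4 : 0 < r ^ 5 - r ^ 3 - r ^ 2 + 3 * r - 1 := by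
      have h5 : 0.012 ≤ r ^ 5 := le_trans (by norm_num) (pow_le_pow_left₀ (by norm_num) h3.le 5)
      nlinarith [mul_pos (sub_pos.mpr h3) h1, mul_pos (mul_pos (sub_pos.mpr h3) h1) hr]
    have h6 : 0 < (r ^ 5 - r ^ 3 - r ^ 2 + 3 * r - 1) / (1 - r) ^ 2 := by positivity
    linarith
  obtain ⟨M, hM⟩ := (hlim.eventually (lt_mem_nhds hgt)).exists
  refine inv_le_growthRate_of_family hb hx hy hS hp hh₁ (by omega) hxS hyS
    (fun _ : Unit ↦ x ^ (-2 : ℤ) * y) (fun _ ↦ 3)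
    (fun _ ↦ mul_mem_ball (zpow_mem_ball hxS (-2)) (mem_ball_one hyS)) (fun _ ↦ by norm_num)
    (fun _ ↦ -2 * h₁) (fun _ ↦ 1)
    (fun _ w hw ↦ ⟨w, hw, by simpa using map_zpow_mul_apply hb hx hy (-2) (w := w)⟩)
    (fun _ ↦ by omega) (fun _ ↦ hb.not_dvd_one) (fun _ ↦ hp) (fun _ i hi h ↦ ?_)
    (fun _ _ _ _ _ _ _ ↦ rfl) hr M Finset.univ (by simpa using hM.le)
  have := mul_right_cancel₀ hh₁.ne' h
  omega

/-- Now x⁻²y no longer preserves X, but x^i y x⁻² y x^j y with i, j ≥ 0 does. Its leading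
coefficient is that of 1 + π^(2h₁-h₂): it is 2 if h₂ = 2h₁, and differs from ±1 modulo p because p
divides neither 1 nor 3. Otherwise it is 1, and the leading exponent is not a multiple of h₁. With
these words the generating function exceeds 1 exactly when r² + 2r > 1. -/
theorem inv_le_growthRate_of_le_two_mul (hb : IsDigitBase p O π) (hx : ∀ u, φ x u = π ^ h₁ * u)
    (hy : ∀ u, φ y u = π ^ h₂ * u + 1) (hS : S.Finite) (hp : ¬ (p : ℤ) ∣ 2) (hp3 : ¬ (p : ℤ) ∣ 3)
    (hh₁ : 0 < h₁) (hh : h₁ < h₂) (hh' : h₂ ≤ 2 * h₁)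
    (hxS : x ∈ S ∨ x⁻¹ ∈ S) (hyS : y ∈ S ∨ y⁻¹ ∈ S)
    {r : ℝ} (hr : 0 < r) (hr1 : r < 1) (hr2 : 1 < r ^ 2 + 2 * r) : r⁻¹ ≤ growthRate S := by
  have hlim := (((tendsto_sum_range_pow_add hr.le hr1 1).add_const (r ^ 2)).add
    ((tendsto_sum_range_pow_add hr.le hr1 2).pow 2)).add
    ((tendsto_sum_range_pow_add hr.le hr1 2).mul (tendsto_sum_range_pow_add hr.le hr1 3))
  have hgt : 1 < r ^ 1 / (1 - r) + r ^ 2 + (r ^ 2 / (1 - r)) ^ 2 +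
      r ^ 2 / (1 - r) * (r ^ 3 / (1 - r)) := by
    have h1 : 0 < 1 - r := by linarith
    have h2 : r ^ 1 / (1 - r) + r ^ 2 + (r ^ 2 / (1 - r)) ^ 2 +
        r ^ 2 / (1 - r) * (r ^ 3 / (1 - r)) - 1 =
        (r ^ 2 + 2 * r - 1) * (r ^ 3 + (1 - r)) / (1 - r) ^ 2 := by
      field_simp
      ring
    have h3 : 0 < r ^ 2 + 2 * r - 1 := by linarith
    have h6 : 0 < (r ^ 2 + 2 * r - 1) * (r ^ 3 + (1 - r)) / (1 - r) ^ 2 := by positivity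
    linarith
  obtain ⟨M, hM⟩ := (hlim.eventually (lt_mem_nhds hgt)).exists
  set c : ℤ := if h₂ = 2 * h₁ then 2 else 1 with hc
  have hone := hb.not_dvd_one
  have hlead : ∀ i j : ℕ, ∀ w ∈ O, ∃ w' ∈ O,
      φ (x ^ (i : ℤ) * y * (x ^ (-2 : ℤ) * y) * (x ^ (j : ℤ) * y)) (π ^ (1 - h₂) * w) =
        π ^ (i * h₁ + (h₂ - 2 * h₁)) * (c + π * w') := by
    intro i j w hw
    have h1 : φ (x ^ (i : ℤ) * y * (x ^ (-2 : ℤ) * y) * (x ^ (j : ℤ) * y)) (π ^ (1 - h₂) * w) =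
        π ^ (i * h₁ + (h₂ - 2 * h₁)) * (1 + π ^ (2 * h₁ - h₂) + π ^ (h₂ + j * h₁) * (1 + π * w)) := by
      rw [map_mul_apply, map_zpow_mul_apply hb hx hy]
      simp only [map_mul_apply, hy, map_zpow_apply hb hx]
      have e1 : π ^ (2 * h₁ - h₂) = π ^ (-(-2 * h₁)) * (π ^ h₂)⁻¹ := by
        rw [← zpow_neg, ← zpow_add₀ hb.ne_zero]; congr 1; ring
      have e2 : π ^ (i * h₁ + (h₂ - 2 * h₁)) = π ^ (i * h₁) * (π ^ h₂ * π ^ (-2 * h₁)) := by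
        rw [← zpow_add₀ hb.ne_zero, ← zpow_add₀ hb.ne_zero]; congr 1; ring
      rw [e1, e2, zpow_add₀ hb.ne_zero h₂, zpow_neg]
      have n1 := zpow_ne_zero h₂ hb.ne_zero
      have n2 := zpow_ne_zero (-2 * h₁) hb.ne_zero
      generalize π ^ h₂ = A at *
      generalize π ^ (-2 * h₁) = B at *
      field_simp
      ring
    have hpos : 0 ≤ h₂ + j * h₁ - 1 := by nlinarith [Int.natCast_nonneg j]
    have hw2 : π ^ (h₂ + j * h₁ - 1) * (1 + π * w) ∈ O :=
      mul_mem (hb.zpow_mem hpos) (add_mem O.one_mem (mul_mem hb.mem hw))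
    by_cases h : h₂ = 2 * h₁
    · refine ⟨_, hw2, ?_⟩
      rw [h1, hb.zpow_eq_mul (h₂ + j * h₁), hc, if_pos h, show 2 * h₁ - h₂ = 0 by omega, zpow_zero]
      push_cast
      ring
    · refine ⟨_, add_mem (hb.zpow_mem (show 0 ≤ 2 * h₁ - h₂ - 1 by omega)) hw2, ?_⟩
      rw [h1, hb.zpow_eq_mul (h₂ + j * h₁), hb.zpow_eq_mul (2 * h₁ - h₂), hc, if_neg h]
      push_cast
      ring
  have hcp : ¬ (p : ℤ) ∣ c := by rw [hc]; split_ifs <;> assumption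
  refine inv_le_growthRate_of_family hb hx hy hS hp hh₁ hh hxS hyS
    (fun i : ℕ × ℕ ↦ x ^ (i.1 : ℤ) * y * (x ^ (-2 : ℤ) * y) * (x ^ (i.2 : ℤ) * y))
    (fun i ↦ i.1 + 1 + 3 + (i.2 + 1))
    (fun i ↦ mul_mem_ball (mul_mem_ball (mul_mem_ball (zpow_mem_ball hxS i.1) (mem_ball_one hyS))
      (mul_mem_ball (zpow_mem_ball hxS (-2)) (mem_ball_one hyS)))
      (mul_mem_ball (zpow_mem_ball hxS i.2) (mem_ball_one hyS))) (fun _ ↦ by omega)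
    (fun i ↦ i.1 * h₁ + (h₂ - 2 * h₁)) (fun _ ↦ c)
    (fun i ↦ hlead i.1 i.2) (fun i ↦ ?_) (fun _ ↦ hcp) (fun _ ↦ ?_) (fun j i hi h ↦ ?_)
    (fun i j w hw w' hw' hww ↦ ?_) hr M (Finset.range M ×ˢ Finset.range M) ?_
  · nlinarith [Int.natCast_nonneg i.1]
  · rw [hc]; split_ifs
    · exact hp3
    · exact hp
  · rw [hc]
    split_ifs with h2
    · exact hone
    · have h3 : h₂ = (i - j.1 + 2) * h₁ := by linear_combination h
      -- A multiple of h₁ in the interval (h₁, 2h₁] can only be 2h₁.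
      rw [h3] at hh hh' h2
      have h4 : 1 < i - j.1 + 2 := by by_contra!; nlinarith
      have h5 : i - j.1 + 2 ≤ 2 := by by_contra!; nlinarith
      exact absurd (by rw [show (i - j.1 + 2 : ℤ) = 2 by omega]) h2
  · obtain ⟨v, hv, h1⟩ := hlead i.1 i.2 w hw
    obtain ⟨v', hv', h1'⟩ := hlead j.1 j.2 w' hw'
    obtain ⟨h2, -⟩ := hb.lead_eq hv hv' hcp hcp (by rw [← h1, ← h1', hww])
    have h3 : (i.1 : ℤ) = j.1 := mul_right_cancel₀ hh₁.ne' (by linarith)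
    rw [h3, map_mul_apply, map_mul_apply φ (_ * (_ * y)),
      EmbeddingLike.apply_eq_iff_eq, map_zpow_mul_apply hb hx hy, map_zpow_mul_apply hb hx hy] at hww
    have h4 := (hb.lead_eq (c := 1) (c' := 1) hw hw' hone hone (by simpa using hww)).1
    have h5 := mul_right_cancel₀ hh₁.ne' h4
    exact Prod.ext (by omega) (by omega)
  · refine hM.le.trans (le_of_eq ?_)
    congr 1
    rw [Finset.sum_mul_sum, Finset.sum_product]
    refine Finset.sum_congr rfl fun i _ ↦ Finset.sum_congr rfl fun j _ ↦ ?_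
    rw [← pow_add]
    congr 1
    dsimp only
    omega

end Hyperbolic

/-! ### Normal forms for generating pairs -/

/-- An action of `G` on a field by the maps `u ↦ π ^ h * u + c` that contains the translation by `1`
and the multiplication by `π`. -/
structure IsAffineAction {K : Type*} [Field K] (p : ℕ) (O : Subring K) (π : K)
    (φ : G →* Equiv.Perm K) : Prop extends IsDigitBase p O π where
  affine : ∀ g, ∃ (h : ℤ) (c : K), ∀ u, φ g u = π ^ h * u + c
  exists_translation : ∃ a, ∀ u, φ a u = u + 1
  exists_scaling : ∃ t, ∀ u, φ t u = π * u

theorem commute_of_eq_or_eq_inv {α : Type*} {φ : G →* Equiv.Perm α} {x x' y : G}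
    (h : x' = x ∨ x' = x⁻¹) (hc : Commute (φ x') (φ y)) : Commute (φ x) (φ y) := by
  rcases h with rfl | rfl
  · exact hc
  · rw [map_inv] at hc
    simpa using hc.inv_left

section

variable {K : Type*} [Field K] {p : ℕ} {O : Subring K} {π : K} {φ : G →* Equiv.Perm K} {S : Set G}

/-- The new coordinate puts the fixed point f of x at 0 and takes the displacement b of f under y as
unit. -/
theorem IsDigitBase.exists_conj (hb : IsDigitBase p O π) {x y : G} {h h' : ℤ} {c c' : K}
    (hh : h ≠ 0) (hx : ∀ u, φ x u = π ^ h * u + c) (hy : ∀ u, φ y u = π ^ h' * u + c')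
    (hxy : ¬ Commute (φ x) (φ y)) :
    ∃ φ' : G →* Equiv.Perm K, (∀ u, φ' x u = π ^ h * u) ∧ ∀ u, φ' y u = π ^ h' * u + 1 := by
  have h1 : 1 - π ^ h ≠ 0 := fun h0 ↦ hh (hb.eq_zero_of_zpow_eq_one (sub_eq_zero.mp h0).symm)
  obtain ⟨f, hf⟩ : ∃ f, π ^ h * f + c = f := ⟨c / (1 - π ^ h), by field_simp; ring⟩
  set b := π ^ h' * f + c' - f with hbdef
  -- If y fixed f as well, the two maps would be affine with a common fixed point and would commute.
  have hb0 : b ≠ 0 := by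
    intro h0
    refine hxy (Equiv.ext fun u ↦ ?_)
    rw [Equiv.Perm.mul_apply, Equiv.Perm.mul_apply, hx, hy, hx, hy]
    linear_combination (π ^ h - 1) * (h0 - hbdef) + (1 - π ^ h') * hf
  set ψ : Equiv.Perm K := (Equiv.mulLeft₀ b hb0).trans (Equiv.addLeft f) with hψ
  have hψu : ∀ u, ψ u = f + b * u := fun u ↦ rfl
  have hconj : ∀ g u v, φ g (f + b * u) = f + b * v → ((MulAut.conj ψ⁻¹).toMonoidHom.comp φ) g u = v := by
    intro g u v huv
    simp only [MonoidHom.comp_apply, MulEquiv.coe_toMonoidHom, MulAut.conj_apply, inv_inv,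
      Equiv.Perm.mul_apply]
    rw [Equiv.Perm.inv_eq_iff_eq, hψu, hψu, huv]
  refine ⟨(MulAut.conj ψ⁻¹).toMonoidHom.comp φ, fun u ↦ hconj _ _ _ ?_, fun u ↦ hconj _ _ _ ?_⟩
  · rw [hx]
    linear_combination hf
  · rw [hy]
    linear_combination -hbdef

theorem IsAffineAction.exists_pos (hφ : IsAffineAction p O π φ) {s : G} {h : ℤ} {c : K} (hh : h ≠ 0)
    (hs : ∀ u, φ s u = π ^ h * u + c) :
    ∃ s', (s' = s ∨ s' = s⁻¹) ∧ ∃ (h : ℤ) (c : K), 0 < h ∧ ∀ u, φ s' u = π ^ h * u + c := by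
  rcases hh.lt_or_gt with h0 | h0
  · refine ⟨s⁻¹, .inr rfl, -h, -π ^ (-h) * c, by omega, fun u ↦ map_inv_apply_of_eq ?_⟩
    have := zpow_ne_zero h hφ.ne_zero
    rw [hs, zpow_neg]
    field_simp
    ring
  · exact ⟨s, .inl rfl, h, c, h0, hs⟩

/-- Every generating set contains, up to inversion, a contraction `x` and another element `y` that
does not commute with it, in one of two normal forms. -/
theorem IsAffineAction.exists_normalized (hφ : IsAffineAction p O π φ)
    (hS : Subgroup.closure S = ⊤) :
    ∃ (x y : G) (h h' : ℤ) (φ' : G →* Equiv.Perm K), (x ∈ S ∨ x⁻¹ ∈ S) ∧ (y ∈ S ∨ y⁻¹ ∈ S) ∧ 0 < h ∧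
      (h' = 0 ∨ h ≤ h') ∧ (∀ u, φ' x u = π ^ h * u) ∧ ∀ u, φ' y u = π ^ h' * u + 1 := by
  have hb := hφ.toIsDigitBase
  have hmem : ∀ g, g ∈ Subgroup.closure S := fun g ↦ hS ▸ Subgroup.mem_top g
  obtain ⟨x, hxS, h, c, hh, hx⟩ : ∃ x ∈ S, ∃ (h : ℤ) (c : K), h ≠ 0 ∧ ∀ u, φ x u = π ^ h * u + c := by
    -- If all generators acted as translations, so would the element that scales by π.
    by_contra! hcon
    have htr : ∀ g, ∃ c : K, ∀ u, φ g u = u + c := by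
      intro g
      induction hmem g using Subgroup.closure_induction with
      | mem s hs =>
        obtain ⟨h, c, hu⟩ := hφ.affine s
        by_cases h0 : h = 0
        · exact ⟨c, by simpa [h0] using hu⟩
        · obtain ⟨u, hu'⟩ := hcon s hs h c h0
          exact absurd (hu u) hu'
      | one => exact ⟨0, by simp⟩
      | mul x y _ _ hx hy =>
        obtain ⟨c, hx⟩ := hx
        obtain ⟨c', hy⟩ := hy
        exact ⟨c' + c, fun u ↦ by rw [map_mul_apply, hy, hx, add_assoc]⟩
      | inv x _ hx =>
        obtain ⟨c, hx⟩ := hx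
        exact ⟨-c, fun u ↦ map_inv_apply_of_eq (by rw [hx]; ring)⟩
    obtain ⟨t, ht⟩ := hφ.exists_scaling
    obtain ⟨c, hc⟩ := htr t
    have h1 := hc 0
    have h2 := hc 1
    rw [ht] at h1 h2
    have h3 : π ^ (1 : ℤ) = 1 := by rw [zpow_one]; linear_combination h2 - h1
    exact absurd (hb.eq_zero_of_zpow_eq_one h3) one_ne_zero
  obtain ⟨y, hyS, hxy⟩ : ∃ y ∈ S, ¬ Commute (φ x) (φ y) := by
    -- Otherwise x would commute with the translation by 1, which forces π ^ h = 1.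
    by_contra! hcon
    have hall : ∀ g, Commute (φ x) (φ g) := by
      intro g
      induction hmem g using Subgroup.closure_induction with
      | mem s hs => exact hcon s hs
      | one => simp
      | mul y z _ _ hy hz => rw [map_mul]; exact hy.mul_right hz
      | inv y _ hy => rw [map_inv]; exact hy.inv_right
    obtain ⟨a, ha⟩ := hφ.exists_translation
    have h1 := DFunLike.congr_fun (hall a).eq (0 : K)
    rw [Equiv.Perm.mul_apply, Equiv.Perm.mul_apply, ha, hx, hx, ha] at h1
    exact hh (hb.eq_zero_of_zpow_eq_one (by linear_combination h1))
  have hmemS : ∀ s s' : G, s ∈ S → (s' = s ∨ s' = s⁻¹) → s' ∈ S ∨ s'⁻¹ ∈ S := by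
    rintro s s' hs (rfl | rfl)
    · exact .inl hs
    · exact .inr (by rwa [inv_inv])
  obtain ⟨x', hx', h, c, hh, hx⟩ := hφ.exists_pos hh hx
  have hxy' : ¬ Commute (φ x') (φ y) := fun hc ↦ hxy (commute_of_eq_or_eq_inv hx' hc)
  obtain ⟨h', c', hy⟩ := hφ.affine y
  by_cases hh' : h' = 0
  · obtain ⟨φ', h1, h2⟩ := hb.exists_conj hh.ne' hx hy hxy'
    exact ⟨x', y, h, h', φ', hmemS _ _ hxS hx', .inl hyS, hh, .inl hh', h1, h2⟩
  · obtain ⟨y', hy', h', c', hh', hy⟩ := hφ.exists_pos hh' hy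
    have hxy'' : ¬ Commute (φ x') (φ y') := fun hc ↦
      hxy' (commute_of_eq_or_eq_inv hy' hc.symm).symm
    rcases le_total h h' with hle | hle
    · obtain ⟨φ', h1, h2⟩ := hb.exists_conj hh.ne' hx hy hxy''
      exact ⟨x', y', h, h', φ', hmemS _ _ hxS hx', hmemS _ _ hyS hy', hh, .inr hle, h1, h2⟩
    · obtain ⟨φ', h1, h2⟩ := hb.exists_conj hh'.ne' hy hx fun hc ↦ hxy'' hc.symm
      exact ⟨y', x', h', h, φ', hmemS _ _ hyS hy', hmemS _ _ hxS hx', hh', .inr hle, h1, h2⟩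

end

/-! ### Power sums at the root -/

theorem sum_Icc_neg {M : Type*} [AddCommMonoid M] (f : ℤ → M) (k : ℕ) :
    ∑ i ∈ Finset.Icc (-k : ℤ) k, f i =
      f 0 + ∑ i ∈ Finset.range k, (f (i + 1) + f (-(i + 1))) := by
  induction k with
  | zero => simp
  | succ k ih =>
    have h : Finset.Icc (-(k + 1 : ℕ) : ℤ) (k + 1 : ℕ) =
        insert (k + 1 : ℤ) (insert (-(k + 1) : ℤ) (Finset.Icc (-k : ℤ) k)) := by
      ext i
      simp only [Finset.mem_Icc, Finset.mem_insert]
      omega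
    rw [h, Finset.sum_insert (by simp; omega), Finset.sum_insert (by simp), ih,
      Finset.sum_range_succ]
    abel

theorem sum_Icc_pow_natAbs (r : ℝ) (k : ℕ) :
    ∑ i ∈ Finset.Icc (-k : ℤ) k, r ^ (i.natAbs + 1) = r + 2 * ∑ i ∈ Finset.range k, r ^ (i + 2) := by
  rw [sum_Icc_neg, Finset.mul_sum]
  simp only [Int.natAbs_zero, zero_add, pow_one, Int.natAbs_neg, add_right_inj]
  refine Finset.sum_congr rfl fun i _ ↦ ?_
  rw [show ((i : ℤ) + 1).natAbs = i + 1 by omega]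
  ring

/-- Multiplication by 1 - r telescopes the sum. For r > 0 the result gives r² + 2r > 1, that is, r⁻¹
< 1 + √2. -/
theorem sq_add_two_mul_of_root {r : ℝ} {k : ℕ}
    (hr : r + 2 * ∑ i ∈ Finset.range k, r ^ (i + 2) = 1) :
    r ^ 2 + 2 * r = 1 + 2 * r ^ (k + 2) := by
  have h1 := mul_neg_geom_sum r k
  have h2 : ∑ i ∈ Finset.range k, r ^ (i + 2) = (∑ i ∈ Finset.range k, r ^ i) * r ^ 2 := by
    simp only [pow_add, Finset.sum_mul]
  rw [h2] at hr
  linear_combination (1 - r) * hr - 2 * r ^ 2 * h1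

/-- After multiplication by 1 - r² the claim is r^(2k+1) (1 + r²) ≤ 2 r^(k+2), which holds since 2k
+ 1 ≥ k + 2 and r < 1. -/
theorem one_le_sum_odd_pow {r : ℝ} {k : ℕ} (hr0 : 0 < r) (hr1 : r < 1) (hk : 1 ≤ k)
    (hr : r ^ 2 + 2 * r = 1 + 2 * r ^ (k + 2)) :
    1 ≤ r + ∑ i ∈ Finset.range k, (r ^ (2 * i + 1) + r ^ (2 * i + 3)) := by
  have h1 := mul_neg_geom_sum (r ^ 2) k
  have h2 : ∑ i ∈ Finset.range k, (r ^ (2 * i + 1) + r ^ (2 * i + 3)) =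
      (∑ i ∈ Finset.range k, (r ^ 2) ^ i) * (r + r ^ 3) := by
    rw [Finset.sum_mul]
    exact Finset.sum_congr rfl fun i _ ↦ by ring
  rw [h2]
  have h3 : (r ^ 2) ^ k * (r + r ^ 3) ≤ 2 * r ^ (k + 2) := by
    have h4 : r ^ (2 * k + 1) ≤ r ^ (k + 2) := pow_le_pow_of_le_one hr0.le hr1.le (by omega)
    have h5 : (r ^ 2) ^ k * (r + r ^ 3) = r ^ (2 * k + 1) * (1 + r ^ 2) := by ring
    rw [h5]
    have h6 : r ^ (2 * k + 1) * (1 + r ^ 2) ≤ r ^ (2 * k + 1) * 2 :=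
      mul_le_mul_of_nonneg_left (by nlinarith) (by positivity)
    linarith
  have h6 : 0 < 1 - r ^ 2 := by nlinarith
  refine le_of_mul_le_mul_left ?_ h6
  linear_combination -hr + h3 - (r + r ^ 3) * h1

/-! ### Lower bounds for arbitrary generating sets -/

section

variable {K : Type*} [Field K] {p : ℕ} {O : Subring K} {π : K} {φ : G →* Equiv.Perm K} {S : Set G}

theorem IsAffineAction.inv_le_growthRate_of_odd (hφ : IsAffineAction p O π φ)
    (hS : IsFiniteGeneratingSet S) {k : ℕ} (hk : 1 ≤ k) (hp : p = 2 * k + 1) {r : ℝ} (hr0 : 0 < r)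
    (hr : r + 2 * ∑ i ∈ Finset.range k, r ^ (i + 2) = 1) : r⁻¹ ≤ growthRate S := by
  have hb := hφ.toIsDigitBase
  obtain ⟨x, y, h, h', φ', hxS, hyS, hh, hh', hx, hy⟩ := hφ.exists_normalized hS.2
  have hr2 := sq_add_two_mul_of_root hr
  have hr3 := pow_pos hr0 (k + 2)
  have hr1 : r < 1 := by
    have : 0 < ∑ i ∈ Finset.range k, r ^ (i + 2) :=
      Finset.sum_pos (fun i _ ↦ by positivity) (by simp; omega)
    linarith
  have hdig : ∀ i ∈ Finset.Icc (-k : ℤ) k, ∀ j ∈ Finset.Icc (-k : ℤ) k, (p : ℤ) ∣ i - j → i = j := by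
    intro i hi j hj hij
    rw [Finset.mem_Icc] at hi hj
    by_contra hne
    have := Int.le_of_dvd (abs_pos.mpr (sub_ne_zero.mpr hne)) ((dvd_abs _ _).mpr hij)
    rcases abs_cases (i - j) with h | h <;> omega
  rcases hh' with rfl | hle
  · have hy' : ∀ u, φ' y u = u + 1 := by simpa using hy
    refine inv_le_growthRate_of_digitWords hb hS.1 _ hdig hh (fun i ↦ y ^ i * x)
      (fun i ↦ i.natAbs + 1) (fun i u ↦ by rw [map_mul_apply, hx, map_zpow_apply_of_add hy'])
      (fun i ↦ mul_mem_ball (zpow_mem_ball hyS i) (mem_ball_one hxS)) (fun i ↦ by omega) hr0 ?_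
    rw [sum_Icc_pow_natAbs, hr]
  -- For p = 3 the root is r = 1/2, so a free semigroup suffices; the later cases need p to divide
  -- neither 2 nor 3.
  rcases hk.eq_or_lt with rfl | hk
  · simp only [Finset.range_one, Finset.sum_singleton, zero_add] at hr
    have : r = 2⁻¹ := by nlinarith
    rw [this, inv_inv]
    exact two_le_growthRate hb hS.1 hh (hh.trans_le hle) hxS hyS hx hy
  have hp2 : ¬ (p : ℤ) ∣ 2 := fun h ↦ by have := Int.le_of_dvd (by norm_num) h; omega
  have hp3 : ¬ (p : ℤ) ∣ 3 := fun h ↦ by have := Int.le_of_dvd (by norm_num) h; omega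
  rcases hle.eq_or_lt with rfl | hlt
  · have hyx : ∀ u, φ' (y * x⁻¹) u = u + 1 := fun u ↦ by
      have h1 : φ' x⁻¹ u = (π ^ h)⁻¹ * u := map_inv_apply_of_eq (by
        rw [hx, mul_inv_cancel_left₀ (zpow_ne_zero h hb.ne_zero)])
      rw [map_mul_apply, h1, hy, mul_inv_cancel_left₀ (zpow_ne_zero h hb.ne_zero)]
    have hball : y * x⁻¹ ∈ ball S 2 :=
      mul_mem_ball (mem_ball_one hyS) (mem_ball_one (by rw [inv_inv]; exact hxS.symm))
    have hball' : (y * x⁻¹)⁻¹ ∈ ball S 2 := by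
      rw [mul_inv_rev, inv_inv]
      exact mul_mem_ball (mem_ball_one hxS) (mem_ball_one (by rw [inv_inv]; exact hyS.symm))
    refine inv_le_growthRate_of_digitWords hb hS.1 _ hdig hh (fun i ↦ (y * x⁻¹) ^ i * x)
      -- For i > 0 the final x⁻¹ of (y x⁻¹)^i cancels against x, which saves two letters.
      (fun i ↦ if 0 < i then 2 * i.natAbs - 1 else 2 * i.natAbs + 1)
      (fun i u ↦ by rw [map_mul_apply, hx, map_zpow_apply_of_add hyx])
      (fun i ↦ ?_) (fun i ↦ by split_ifs <;> omega) hr0 ?_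
    · split_ifs with hi
      · obtain ⟨n, rfl⟩ : ∃ n : ℕ, i = n + 1 := ⟨(i - 1).toNat, by omega⟩
        rw [zpow_add_one, ← mul_assoc, inv_mul_cancel_right, zpow_natCast]
        exact ball_mono S (by omega) (mul_mem_ball (pow_mem_ball hball n) (mem_ball_one hyS))
      · obtain ⟨n, rfl⟩ : ∃ n : ℕ, i = -n := ⟨(-i).toNat, by omega⟩
        rw [zpow_neg, ← inv_zpow, zpow_natCast]
        exact ball_mono S (by omega) (mul_mem_ball (pow_mem_ball hball' n) (mem_ball_one hxS))
    · rw [sum_Icc_neg]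
      refine (one_le_sum_odd_pow hr0 hr1 hk.le hr2).trans (le_of_eq ?_)
      simp only [lt_irrefl, if_false, Int.natAbs_zero, mul_zero, zero_add, pow_one]
      congr 1
      refine Finset.sum_congr rfl fun i _ ↦ ?_
      rw [if_pos (by omega), if_neg (by omega)]
      congr 2
  · have hr4 : 1 < r ^ 2 + 2 * r := by linarith
    rcases le_or_gt h' (2 * h) with hle | hgt
    · exact inv_le_growthRate_of_le_two_mul hb hx hy hS.1 hp2 hp3 hh hlt hle hxS hyS hr0 hr1 hr4
    · exact inv_le_growthRate_of_two_mul_lt hb hx hy hS.1 hp2 hh hgt hxS hyS hr0 hr1 hr4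

theorem IsAffineAction.inv_le_growthRate_of_binary (hφ : IsAffineAction p O π φ)
    (hS : IsFiniteGeneratingSet S) {r : ℝ} (hr0 : 2⁻¹ ≤ r) (hr : r + r ^ 2 = 1) :
    r⁻¹ ≤ growthRate S := by
  have hb := hφ.toIsDigitBase
  obtain ⟨x, y, h, h', φ', hxS, hyS, hh, hh', hx, hy⟩ := hφ.exists_normalized hS.2
  rcases hh' with rfl | hle
  · have hy' : ∀ u, φ' y u = u + 1 := by simpa using hy
    refine inv_le_growthRate_of_digitWords hb hS.1 {0, 1} ?_ hh (fun i ↦ y ^ i * x)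
      (fun i ↦ i.natAbs + 1) (fun i u ↦ by rw [map_mul_apply, hx, map_zpow_apply_of_add hy'])
      (fun i ↦ mul_mem_ball (zpow_mem_ball hyS i) (mem_ball_one hxS)) (fun i ↦ by omega)
      (by linarith) ?_
    · have := hb.not_dvd_one
      simpa using this
    · simp [hr]
  · exact (inv_le_of_inv_le₀ (by norm_num) hr0).trans
      (two_le_growthRate hb hS.1 hh (hh.trans_le hle) hxS hyS hx hy)

theorem IsAffineAction.inv_le_growthRate_of_nonadjacent (hφ : IsAffineAction p O π φ)
    (htwo : ∀ w ∈ O, (2 : K) ≠ π ^ 2 * w)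
    (hS : IsFiniteGeneratingSet S) {r : ℝ} (hr0 : 2⁻¹ ≤ r) (hr : r + 2 * r ^ 3 = 1) :
    r⁻¹ ≤ growthRate S := by
  have hb := hφ.toIsDigitBase
  obtain ⟨x, y, h, h', φ', hxS, hyS, hh, hh', hx, hy⟩ := hφ.exists_normalized hS.2
  rcases hh' with rfl | hle
  · have hy' : ∀ u, φ' y u = u + 1 := by simpa using hy
    exact GroupGrowth.inv_le_growthRate_of_nonadjacent hb hS.1 htwo hh hxS hyS hx hy'
      (by linarith) hr.ge
  · exact (inv_le_of_inv_le₀ (by norm_num) hr0).trans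
      (two_le_growthRate hb hS.1 hh (hh.trans_le hle) hxS hyS hx hy)

end

theorem IsDigitBase.isAffineAction {K : Type*} [Field K] {p : ℕ} {O : Subring K} {π : K}
    (hb : IsDigitBase p O π) {φ : G →* Equiv.Perm K} {a t : G}
    (hgen : Subgroup.closure {a, t} = ⊤) (ha : ∀ u, φ a u = u + 1) (ht : ∀ u, φ t u = π * u) :
    IsAffineAction p O π φ where
  toIsDigitBase := hb
  exists_translation := ⟨a, ha⟩
  exists_scaling := ⟨t, ht⟩
  affine g := by
    have hg : g ∈ Subgroup.closure {a, t} := hgen ▸ Subgroup.mem_top g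
    induction hg using Subgroup.closure_induction with
    | mem s hs =>
      rcases hs with rfl | rfl
      · exact ⟨0, 1, by simpa using ha⟩
      · exact ⟨1, 0, by simpa using ht⟩
    | one => exact ⟨0, 0, by simp⟩
    | mul x y _ _ hx hy =>
      obtain ⟨h, c, hx⟩ := hx
      obtain ⟨h', c', hy⟩ := hy
      refine ⟨h + h', π ^ h * c' + c, fun u ↦ ?_⟩
      rw [map_mul_apply, hy, hx, zpow_add₀ hb.ne_zero]
      ring
    | inv x _ hx =>
      obtain ⟨h, c, hx⟩ := hx
      refine ⟨-h, -(π ^ (-h) * c), fun u ↦ map_inv_apply_of_eq ?_⟩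
      have := zpow_ne_zero h hb.ne_zero
      rw [hx, zpow_neg]
      field_simp
      ring

theorem realizesMinimalGrowthRate_of_bounds {S : Set G} (hS : IsFiniteGeneratingSet S) {z : ℝ}
    (hle : growthRate S ≤ z) (hge : ∀ T : Set G, IsFiniteGeneratingSet T → z ≤ growthRate T) :
    RealizesMinimalGrowthRate S ∧ minimalGrowthRate G = z := by
  have hz : growthRate S = z := le_antisymm hle (hge S hS)
  have hmin : minimalGrowthRate G = z := by
    refine IsLeast.csInf_eq ⟨⟨S, hS, hz⟩, ?_⟩
    rintro _ ⟨T, hT, rfl⟩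
    exact hge T hT
  exact ⟨⟨hS, hz.trans hmin.symm⟩, hmin⟩

end GroupGrowth

open GroupGrowth

/-! ### The lamplighter group acting on Laurent series -/

namespace Lamplighter

variable (p : ℕ)

theorem inl_single (i : ℤ) (c : ZMod p) (n : ℤ) (hc : (n : ZMod p) = c) :
    (SemidirectProduct.inl (Multiplicative.ofAdd (Finsupp.single i c)) : Lamplighter p) =
      t p ^ i * a p ^ n * (t p ^ i)⁻¹ := by
  have ht : t p ^ i = SemidirectProduct.inr (Multiplicative.ofAdd i) := by
    rw [t, ← map_zpow, ← ofAdd_zsmul, smul_eq_mul, mul_one]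
  have ha : a p ^ n = SemidirectProduct.inl (Multiplicative.ofAdd (Finsupp.single 0 c)) := by
    rw [a, ← map_zpow, ← ofAdd_zsmul, Finsupp.smul_single, zsmul_one, hc]
  rw [ht, ha, ← map_inv, ← SemidirectProduct.inl_aut]
  congr 1
  refine Multiplicative.toAdd.injective ?_
  change _ = Finsupp.domCongr (Equiv.addRight i) (Finsupp.single 0 c)
  simp [Finsupp.domCongr]

theorem isFiniteGeneratingSet : IsFiniteGeneratingSet {a p, t p} := by
  refine ⟨by simp, eq_top_iff.mpr fun g _ ↦ ?_⟩
  have ha : a p ∈ Subgroup.closure {a p, t p} := Subgroup.subset_closure (by simp)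
  have ht : t p ∈ Subgroup.closure {a p, t p} := Subgroup.subset_closure (by simp)
  rw [← SemidirectProduct.inl_left_mul_inr_right g]
  refine mul_mem ?_ ?_
  · suffices h : ∀ f : ℤ →₀ ZMod p, SemidirectProduct.inl (Multiplicative.ofAdd f) ∈
        Subgroup.closure {a p, t p} from h g.left.toAdd
    intro f
    induction f using Finsupp.induction_linear with
    | zero => simp
    | add f f' hf hf' =>
      rw [ofAdd_add, map_mul]
      exact mul_mem hf hf'
    | single i c =>
      obtain ⟨n, hn⟩ := ZMod.intCast_surjective c
      rw [inl_single p i c n hn]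
      exact mul_mem (mul_mem (zpow_mem ht i) (zpow_mem ha n)) (inv_mem (zpow_mem ht i))
  · have h : (SemidirectProduct.inr g.right : Lamplighter p) = t p ^ g.right.toAdd := by
      rw [t, ← map_zpow, ← ofAdd_zsmul, smul_eq_mul, mul_one]
      rfl
    rw [h]
    exact zpow_mem ht _

theorem commute_conj (i : ℕ) : Commute (t p ^ i * a p * (t p ^ i)⁻¹) (a p) := by
  have h := inl_single p i 1 1 (by simp)
  rw [zpow_natCast, zpow_one] at h
  rw [← h, a]
  exact (Commute.all _ _).map SemidirectProduct.inl

theorem a_zpow_congr {m n : ℤ} (h : (m : ZMod p) = n) : a p ^ m = a p ^ n := by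
  have h1 := inl_single p 0 n m h
  rw [inl_single p 0 n n rfl] at h1
  simpa using h1.symm

variable [Fact p.Prime]

/-- The Laurent polynomial of a configuration. -/
noncomputable def toLaurent : (ℤ →₀ ZMod p) →+ LaurentSeries (ZMod p) :=
  Finsupp.liftAddHom fun i ↦ HahnSeries.single.addMonoidHom i

theorem toLaurent_single (i : ℤ) (c : ZMod p) :
    toLaurent p (Finsupp.single i c) = HahnSeries.single i c := by
  simp [toLaurent]
  rfl

theorem toLaurent_shift (m : ℤ) (f : ℤ →₀ ZMod p) :
    toLaurent p (Finsupp.domCongr (Equiv.addRight m) f) =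
      HahnSeries.single 1 1 ^ m * toLaurent p f := by
  induction f using Finsupp.induction_linear with
  | zero => simp
  | add f f' hf hf' => rw [map_add, map_add, hf, hf', map_add, mul_add]
  | single i c =>
    rw [← RatFunc.single_zpow, toLaurent_single, HahnSeries.single_mul_single, one_mul, add_comm]
    simp [Finsupp.domCongr, toLaurent_single]

theorem single_one_ne_zero : (HahnSeries.single 1 1 : LaurentSeries (ZMod p)) ≠ 0 :=
  HahnSeries.single_ne_zero one_ne_zero

theorem isDigitBase : IsDigitBase p (HahnSeries.ofPowerSeries ℤ (ZMod p)).range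
    (HahnSeries.single 1 1 : LaurentSeries (ZMod p)) where
  mem := ⟨PowerSeries.X, HahnSeries.ofPowerSeries_X⟩
  ne_zero := single_one_ne_zero p
  not_dvd_one h := (Fact.out : p.Prime).one_lt.ne' (by exact_mod_cast Int.eq_one_of_dvd_one (by omega) h)
  dvd := by
    rintro c _ ⟨w, rfl⟩ h
    rw [← HahnSeries.ofPowerSeries_X, ← map_mul, ← map_intCast (HahnSeries.ofPowerSeries ℤ (ZMod p))] at h
    have h1 := congrArg PowerSeries.constantCoeff (HahnSeries.ofPowerSeries_injective h)
    rw [map_mul, PowerSeries.constantCoeff_X, zero_mul, map_intCast] at h1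
    exact (ZMod.intCast_zmod_eq_zero_iff_dvd c p).mp h1

/-- The action of the lamplighter group on Laurent series: configurations act by translations and
`ℤ` by multiplication with the powers of the variable. -/
noncomputable def affineAction : Lamplighter p →* Equiv.Perm (LaurentSeries (ZMod p)) :=
  SemidirectProduct.lift
    { toFun := fun f ↦ Equiv.addRight (toLaurent p f.toAdd)
      map_one' := by ext1 u; simp
      map_mul' := fun f g ↦ by ext1 u; simp [add_comm, add_left_comm] }
    (zpowersHom _ (Equiv.mulLeft₀ _ (single_one_ne_zero p))) (by
      have hz : ∀ (m : ℤ) u, (Equiv.mulLeft₀ _ (single_one_ne_zero p) ^ m) u =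
          (HahnSeries.single 1 1 : LaurentSeries (ZMod p)) ^ m * u := fun m u ↦ by
        simpa using map_zpow_apply_of_mul (φ := MonoidHom.id _)
          (x := Equiv.mulLeft₀ _ (single_one_ne_zero p)) (single_one_ne_zero p) (fun u ↦ rfl) m u
      refine fun m ↦ MonoidHom.ext fun f ↦ ?_
      change Equiv.addRight (toLaurent p (Finsupp.domCongr (Equiv.addRight m.toAdd) f.toAdd)) =
        Equiv.mulLeft₀ _ (single_one_ne_zero p) ^ m.toAdd * Equiv.addRight (toLaurent p f.toAdd) *
          (Equiv.mulLeft₀ _ (single_one_ne_zero p) ^ m.toAdd)⁻¹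
      rw [eq_mul_inv_iff_mul_eq]
      ext1 u
      rw [Equiv.Perm.mul_apply, Equiv.Perm.mul_apply, hz, hz, toLaurent_shift, Equiv.coe_addRight,
        Equiv.coe_addRight, mul_add])

theorem isAffineAction : IsAffineAction p (HahnSeries.ofPowerSeries ℤ (ZMod p)).range
    (HahnSeries.single 1 1) (affineAction p) :=
  (isDigitBase p).isAffineAction (isFiniteGeneratingSet p).2
    (fun u ↦ by
      simp only [affineAction, a, SemidirectProduct.lift_inl, MonoidHom.coe_mk, OneHom.coe_mk,
        Equiv.coe_addRight, toAdd_ofAdd, toLaurent_single]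
      rfl)
    (fun u ↦ by simp [affineAction, t])

end Lamplighter

/-! ### The Baumslag–Solitar group acting on the p-adic numbers -/

namespace BS

variable (p : ℕ)

theorem isFiniteGeneratingSet : IsFiniteGeneratingSet {a p, t p} := by
  refine ⟨by simp, ?_⟩
  rw [← PresentedGroup.closure_range_of (bsRelators p)]
  congr 1
  ext g
  simp [a, t, eq_comm]

theorem t_mul_a : t p * a p = a p ^ p * t p := by
  have h := PresentedGroup.one_of_mem (rels := bsRelators p) (Set.mem_singleton _)
  rw [map_mul, map_mul, map_mul, map_inv, map_inv, map_pow, mul_inv_eq_one, mul_inv_eq_iff_eq_mul] at h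
  exact h

theorem a_zpow_mul_t (q : ℤ) : a p ^ (p * q) * t p = t p * a p ^ q := by
  have h : t p * a p * (t p)⁻¹ = a p ^ p := by rw [t_mul_a, mul_inv_cancel_right]
  rw [zpow_mul, zpow_natCast, ← h, conj_zpow, inv_mul_cancel_right]

theorem commute_conj (i : ℕ) : Commute (t p ^ i * a p * (t p ^ i)⁻¹) (a p) := by
  suffices h : t p ^ i * a p * (t p ^ i)⁻¹ = a p ^ p ^ i by
    rw [h]
    exact Commute.pow_self _ _
  induction i with
  | zero => simp
  | succ i ih =>
    have h : t p * a p * (t p)⁻¹ = a p ^ p := by rw [t_mul_a, mul_inv_cancel_right]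
    calc t p ^ (i + 1) * a p * (t p ^ (i + 1))⁻¹ = t p * (t p ^ i * a p * (t p ^ i)⁻¹) * (t p)⁻¹ := by
          rw [pow_succ']; group
      _ = a p ^ p ^ (i + 1) := by rw [ih, ← conj_pow, h, ← pow_mul, pow_succ']

variable [Fact p.Prime]

theorem padic_ne_zero : (p : ℚ_[p]) ≠ 0 := by
  exact_mod_cast (Fact.out : p.Prime).ne_zero

theorem isDigitBase : IsDigitBase p (PadicInt.subring p) (p : ℚ_[p]) where
  mem := natCast_mem _ p
  ne_zero := padic_ne_zero p
  not_dvd_one h := (Fact.out : p.Prime).one_lt.ne' (by exact_mod_cast Int.eq_one_of_dvd_one (by omega) h)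
  dvd c w hw h := by
    rw [← Padic.norm_intCast_lt_one_iff, h, norm_mul]
    have h1 : ‖w‖ ≤ 1 := hw
    exact (mul_le_of_le_one_right (norm_nonneg _) h1).trans_lt Padic.norm_p_lt_one

/-- Otherwise 1 would be divisible by 2 in the 2-adic integers. For Laurent series over F₂ the
analogue fails, since 2 = 0 there; this is where the two groups part for p = 2. -/
theorem two_ne (w : ℚ_[2]) (hw : w ∈ PadicInt.subring 2) : (2 : ℚ_[2]) ≠ ((2 : ℕ) : ℚ_[2]) ^ 2 * w := by
  intro h
  have h1 := (isDigitBase 2).dvd 1 w hw (by push_cast at h ⊢; linear_combination h / 2)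
  norm_num at h1

/-- The affine action of `BS(1, p)` on the `p`-adic numbers. -/
noncomputable def affineAction : BS p →* Equiv.Perm ℚ_[p] :=
  PresentedGroup.toGroup (f := ![Equiv.addRight 1, Equiv.mulLeft₀ (p : ℚ_[p]) (padic_ne_zero p)]) (by
    have hpow : ∀ (n : ℕ) u, (Equiv.addRight (1 : ℚ_[p]) ^ n) u = u + n := fun n u ↦ by
      simp
    intro r hr
    rw [Set.mem_singleton_iff.mp hr]
    simp only [map_mul, map_inv, map_pow, FreeGroup.lift_apply_of, Matrix.cons_val_zero, Matrix.cons_val_one]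
    rw [mul_inv_eq_one, mul_inv_eq_iff_eq_mul]
    ext1 u
    rw [Equiv.Perm.mul_apply, Equiv.Perm.mul_apply, hpow]
    change (p : ℚ_[p]) * (u + 1) = p * u + p
    ring)

theorem isAffineAction : IsAffineAction p (PadicInt.subring p) (p : ℚ_[p]) (affineAction p) :=
  (isDigitBase p).isAffineAction (isFiniteGeneratingSet p).2
    (fun u ↦ by rw [affineAction, a, PresentedGroup.toGroup.of]; rfl)
    (fun u ↦ by rw [affineAction, t, PresentedGroup.toGroup.of]; rfl)

end BS

/-! ### Roots of the growth polynomials and balanced digits -/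

theorem eval_growthPoly (k : ℕ) {z : ℝ} (hz : z ≠ 0) :
    (growthPoly k).eval z =
      z ^ (k + 1) * (1 - (z⁻¹ + 2 * ∑ i ∈ Finset.range k, z⁻¹ ^ (i + 2))) := by
  have h1 : ∑ i ∈ Finset.range k, 2 * z ^ i =
      z ^ (k + 1) * (2 * ∑ i ∈ Finset.range k, z⁻¹ ^ (i + 2)) := by
    rw [← Finset.sum_range_reflect, Finset.mul_sum, Finset.mul_sum]
    refine Finset.sum_congr rfl fun i hi ↦ ?_
    have h2 : k + 1 = (k - 1 - i) + (i + 2) := by have := Finset.mem_range.mp hi; omega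
    rw [h2, pow_add z, inv_pow]
    field_simp
  rw [mul_sub, mul_add, ← h1]
  simp only [growthPoly, eval_sub, eval_pow, eval_X, eval_finsetSum, eval_mul, eval_C]
  rw [pow_succ, mul_inv_cancel_right₀ hz]
  ring

theorem isRoot_growthPoly_iff {k : ℕ} {z : ℝ} (hz : z ≠ 0) :
    (growthPoly k).IsRoot z ↔ z⁻¹ + 2 * ∑ i ∈ Finset.range k, z⁻¹ ^ (i + 2) = 1 := by
  rw [IsRoot.def, eval_growthPoly k hz, mul_eq_zero, or_iff_right (pow_ne_zero _ hz), sub_eq_zero,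
    eq_comm]

/-- In r = 1/z the root equation reads g(r) = 1 with g strictly increasing on r ≥ 0, g(0) = 0 and
g(1) ≥ 1. -/
theorem exists_isUniquePositiveRoot_growthPoly (k : ℕ) :
    ∃ z : ℝ, 1 ≤ z ∧ z⁻¹ + 2 * ∑ i ∈ Finset.range k, z⁻¹ ^ (i + 2) = 1 ∧
      IsUniquePositiveRoot (growthPoly k) z := by
  set g : ℝ → ℝ := fun r ↦ r + 2 * ∑ i ∈ Finset.range k, r ^ (i + 2)
  have hmono : ∀ r s, 0 ≤ r → r < s → g r < g s := fun r s hr hrs ↦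
    add_lt_add_of_lt_of_le hrs (mul_le_mul_of_nonneg_left
      (Finset.sum_le_sum fun i _ ↦ pow_le_pow_left₀ hr hrs.le _) zero_le_two)
  obtain ⟨r, ⟨hr0, hr1⟩, hr⟩ : (1 : ℝ) ∈ g '' Set.Icc 0 1 := by
    refine intermediate_value_Icc zero_le_one (by fun_prop) ⟨?_, ?_⟩
    · simp [g]
    · simp [g]
  have hpos : 0 < r := hr0.lt_of_ne fun h ↦ by simp [g, ← h] at hr
  have hroot : r⁻¹⁻¹ + 2 * ∑ i ∈ Finset.range k, r⁻¹⁻¹ ^ (i + 2) = 1 := by rw [inv_inv]; exact hr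
  refine ⟨r⁻¹, (one_le_inv₀ hpos).mpr hr1, hroot, inv_pos.mpr hpos,
    (isRoot_growthPoly_iff (by positivity)).mpr hroot, fun s hs hsr ↦ ?_⟩
  have hs1 : g s⁻¹ = 1 := (isRoot_growthPoly_iff hs.ne').mp hsr
  rw [← inv_eq_iff_eq_inv]
  rcases lt_trichotomy s⁻¹ r with h | h | h
  · exact absurd (hmono _ _ (by positivity) h) (by rw [hs1, show g r = 1 from hr]; exact lt_irrefl 1)
  · exact h
  · exact absurd (hmono _ _ hr0 h) (by rw [hs1, show g r = 1 from hr]; exact lt_irrefl 1)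

/-- The balanced remainder of an integer modulo `2 * k + 1`. -/
theorem exists_balanced_digit (k : ℕ) (c : ℤ) : ∃ i ∈ Finset.Icc (-k : ℤ) k, ∃ q : ℤ,
    c = i + (2 * k + 1 : ℕ) * q ∧ i.natAbs + q.natAbs ≤ c.natAbs := by
  have hp : (0 : ℤ) < 2 * k + 1 := by omega
  have h1 := Int.emod_nonneg (c + k) hp.ne'
  have h2 := Int.emod_lt_of_pos (c + k) hp
  have h3 := Int.emod_add_mul_ediv (c + k) (2 * k + 1)
  generalize (c + k) % (2 * k + 1) = m at *
  generalize (c + k) / (2 * k + 1) = q at *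
  refine ⟨m - k, Finset.mem_Icc.mpr ⟨by omega, by omega⟩, q, by push_cast; linarith, ?_⟩
  -- If q ≠ 0, then |c| ≥ (2k+1)|q| - |i| ≥ |q| + 2k - |i| ≥ |q| + |i|, as |i| ≤ k. The product k *
  -- q is isolated to serve `omega` as an atom.
  have h4 : c = m - k + 2 * (k * q) + q := by linarith
  rcases lt_trichotomy q 0 with h | rfl | h
  · have : (k : ℤ) * q ≤ -k := by nlinarith
    omega
  · omega
  · have : (k : ℤ) ≤ k * q := by nlinarith
    omega

/-! ### Matching the bounds -/

theorem Lamplighter.realizes_of_odd {k : ℕ} (hk : 1 ≤ k) [Fact (2 * k + 1).Prime] {z : ℝ}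
    (hz : 1 ≤ z) (hroot : z⁻¹ + 2 * ∑ i ∈ Finset.range k, z⁻¹ ^ (i + 2) = 1) :
    RealizesMinimalGrowthRate {Lamplighter.a (2 * k + 1), Lamplighter.t (2 * k + 1)} ∧
      minimalGrowthRate (Lamplighter (2 * k + 1)) = z := by
  refine realizesMinimalGrowthRate_of_bounds (Lamplighter.isFiniteGeneratingSet _) ?_ fun T hT ↦ ?_
  · refine growthRate_le_of_digits (Lamplighter.commute_conj _) (Finset.Icc (-k : ℤ) k)
      (fun c ↦ ?_) hz (by rw [sum_Icc_pow_natAbs, hroot])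
    obtain ⟨i, hi, q, hc, hle⟩ := exists_balanced_digit k c
    refine ⟨i, hi, 0, ?_, by omega⟩
    rw [Lamplighter.a_zpow_congr (2 * k + 1) (m := c) (n := i), zpow_zero, mul_one]
    rw [hc, Int.cast_add, Int.cast_mul, Int.cast_natCast, ZMod.natCast_self, zero_mul, add_zero]
  · rw [← inv_inv z]
    exact (Lamplighter.isAffineAction _).inv_le_growthRate_of_odd hT hk rfl
      (inv_pos.mpr (by linarith)) hroot

theorem BS.realizes_of_odd {k : ℕ} (hk : 1 ≤ k) [Fact (2 * k + 1).Prime] {z : ℝ}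
    (hz : 1 ≤ z) (hroot : z⁻¹ + 2 * ∑ i ∈ Finset.range k, z⁻¹ ^ (i + 2) = 1) :
    RealizesMinimalGrowthRate {BS.a (2 * k + 1), BS.t (2 * k + 1)} ∧
      minimalGrowthRate (BS (2 * k + 1)) = z := by
  refine realizesMinimalGrowthRate_of_bounds (BS.isFiniteGeneratingSet _) ?_ fun T hT ↦ ?_
  · refine growthRate_le_of_digits (BS.commute_conj _) (Finset.Icc (-k : ℤ) k)
      (fun c ↦ ?_) hz (by rw [sum_Icc_pow_natAbs, hroot])
    obtain ⟨i, hi, q, hc, hle⟩ := exists_balanced_digit k c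
    refine ⟨i, hi, q, ?_, hle⟩
    rw [mul_assoc, ← BS.a_zpow_mul_t, ← mul_assoc, ← zpow_add, ← hc]
  · rw [← inv_inv z]
    exact (BS.isAffineAction _).inv_le_growthRate_of_odd hT hk rfl
      (inv_pos.mpr (by linarith)) hroot

theorem Lamplighter.realizes_two :
    RealizesMinimalGrowthRate {Lamplighter.a 2, Lamplighter.t 2} ∧
      minimalGrowthRate (Lamplighter 2) = (1 + Real.sqrt 5) / 2 := by
  have h5 : Real.sqrt 5 ^ 2 = 5 := Real.sq_sqrt (by norm_num)
  have hlo : 1 ≤ Real.sqrt 5 := Real.one_le_sqrt.mpr (by norm_num)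
  have hhi : Real.sqrt 5 ≤ 3 := by nlinarith
  set z := (1 + Real.sqrt 5) / 2 with hz
  have hz1 : 1 ≤ z := by linarith
  have hroot : z⁻¹ + z⁻¹ ^ 2 = 1 := by
    have : z ^ 2 = z + 1 := by rw [hz]; linear_combination h5 / 4
    field_simp
    linarith
  refine realizesMinimalGrowthRate_of_bounds (Lamplighter.isFiniteGeneratingSet _) ?_ fun T hT ↦ ?_
  · refine growthRate_le_of_digits (Lamplighter.commute_conj _) {0, 1}
      (fun c ↦ ⟨c % 2, ?_, 0, ?_, by omega⟩) hz1 (by simp [← hroot])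
    · simp only [Finset.mem_insert, Finset.mem_singleton]
      omega
    · rw [Lamplighter.a_zpow_congr 2 (m := c) (n := c % 2), zpow_zero, mul_one]
      exact (ZMod.intCast_mod c 2).symm
  · rw [← inv_inv z]
    refine (Lamplighter.isAffineAction 2).inv_le_growthRate_of_binary hT ?_ hroot
    exact inv_anti₀ (by linarith) (by linarith)

theorem BS.realizes_two {z : ℝ} (hz1 : 1 ≤ z) (hz2 : z ≤ 2) (hroot : z⁻¹ + 2 * z⁻¹ ^ 3 = 1) :
    RealizesMinimalGrowthRate {BS.a 2, BS.t 2} ∧ minimalGrowthRate (BS 2) = z := by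
  refine realizesMinimalGrowthRate_of_bounds (BS.isFiniteGeneratingSet _) ?_ fun T hT ↦ ?_
  · exact growthRate_le_of_nonadjacent (fun q ↦ by exact_mod_cast BS.a_zpow_mul_t 2 q)
      (BS.commute_conj _) hz1 hroot.le
  · rw [← inv_inv z]
    exact (BS.isAffineAction 2).inv_le_growthRate_of_nonadjacent BS.two_ne hT
      (inv_anti₀ (by linarith) hz2) hroot

theorem exists_isUniquePositiveRoot_cubic :
    ∃ β : ℝ, IsUniquePositiveRoot (X ^ 3 - X ^ 2 - 2) β ∧ |β - 1.69562| < 0.000005 := by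
  have heval : ∀ z : ℝ, (X ^ 3 - X ^ 2 - 2 : ℝ[X]).eval z = z ^ 3 - z ^ 2 - 2 := by simp
  obtain ⟨β, ⟨h1, h2⟩, hβ⟩ : (0 : ℝ) ∈ (fun z : ℝ ↦ z ^ 3 - z ^ 2 - 2) ''
      -- The polynomial changes sign on this interval, whose points lie within 0.000004 of 1.69562.
      Set.Icc 1.695616 1.695624 :=
    intermediate_value_Icc (by norm_num) (by fun_prop) ⟨by norm_num, by norm_num⟩
  dsimp only at hβ
  refine ⟨β, ⟨by linarith, by rw [IsRoot.def, heval, hβ], fun s hs hsr ↦ ?_⟩, ?_⟩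
  · rw [IsRoot.def, heval] at hsr
    have hs1 : 1 < s := by by_contra!; nlinarith [sq_nonneg s]
    have h3 : (s - β) * (s ^ 2 + s * β + β ^ 2 - s - β) = 0 := by linear_combination hsr - hβ
    rcases mul_eq_zero.mp h3 with h | h
    · linarith
    · nlinarith
  · rw [abs_lt]
    constructor <;> linarith

theorem theorem1 :
    (∀ p : ℕ, p.Prime →
      GroupGrowth.RealizesMinimalGrowthRate {Lamplighter.a p, Lamplighter.t p} ∧
      GroupGrowth.RealizesMinimalGrowthRate {BS.a p, BS.t p}) ∧
    (∀ k : ℕ, (2 * k + 1).Prime → ∃ ω : ℝ,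
      IsUniquePositiveRoot (growthPoly k) ω ∧
      GroupGrowth.minimalGrowthRate (Lamplighter (2 * k + 1)) = ω ∧
      GroupGrowth.minimalGrowthRate (BS (2 * k + 1)) = ω) ∧
    ∃ β : ℝ,
      IsUniquePositiveRoot (X ^ 3 - X ^ 2 - 2) β ∧
      |β - 1.69562| < 0.000005 ∧
      GroupGrowth.minimalGrowthRate (Lamplighter 2) = (1 + Real.sqrt 5) / 2 ∧
      GroupGrowth.minimalGrowthRate (BS 2) = β ∧
      (1 + Real.sqrt 5) / 2 < β := by
  obtain ⟨β, hβ, hβ'⟩ := exists_isUniquePositiveRoot_cubic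
  obtain ⟨hlo, hhi⟩ := abs_lt.mp hβ'
  have hβ1 : 1.69 < β := by linarith
  have hβ2 : β ≤ 2 := by linarith
  have hβroot : β⁻¹ + 2 * β⁻¹ ^ 3 = 1 := by
    have h := hβ.2.1
    simp only [IsRoot.def, eval_sub, eval_pow, eval_X, eval_ofNat] at h
    field_simp
    linear_combination -h
  have hBS := BS.realizes_two (by linarith) hβ2 hβroot
  have hodd : ∀ k : ℕ, (2 * k + 1).Prime → 1 ≤ k := fun k hk ↦ by
    by_contra! h
    obtain rfl : k = 0 := by omega
    exact Nat.not_prime_one hk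
  refine ⟨fun p hp ↦ ?_, fun k hk ↦ ?_, β, hβ, hβ', Lamplighter.realizes_two.2, hBS.2, ?_⟩
  · rcases hp.eq_two_or_odd' with rfl | ⟨k, rfl⟩
    · exact ⟨Lamplighter.realizes_two.1, hBS.1⟩
    · have := Fact.mk hp
      obtain ⟨z, hz, hroot, -⟩ := exists_isUniquePositiveRoot_growthPoly k
      exact ⟨(Lamplighter.realizes_of_odd (hodd k hp) hz hroot).1,
        (BS.realizes_of_odd (hodd k hp) hz hroot).1⟩
  · have := Fact.mk hk
    obtain ⟨z, hz, hroot, huniq⟩ := exists_isUniquePositiveRoot_growthPoly k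
    exact ⟨z, huniq, (Lamplighter.realizes_of_odd (hodd k hk) hz hroot).2,
      (BS.realizes_of_odd (hodd k hk) hz hroot).2⟩
  · have h5 : Real.sqrt 5 < 2.3 := by
      rw [Real.sqrt_lt' (by norm_num)]
      norm_num
    linarith
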